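/- A \emph{clone} on a set $X$ is a set of finitary operations $f:X^n\to X$, $n\ge 1$, that contains all projections and is closed under composition. The clones on $X$, ordered by inclusion, form a complete lattice whose greatest element $\mathcal O$ is the clone of all operations $X^n\to X$, $n\ge 1$; its coatoms (the maximal elements among the clones different from $\mathcal O$) are called \emph{precomplete} (or \emph{maximal}) clones. The lattice is \emph{dually atomic} if every clone $\mathcal C\neq\mathcal O$ is contained in a precomplete clone. For an infinite set $A\subseteq\mathbb N$ let $h_A:\mathbb N\to\mathbb N$, $h_A(n)=\min\{a\in A: a>n\}$. For a filter $U$ of infinite subsets of $\mathbb N$ let $\mathcal C_U$ be the clone on $\mathbb N$ generated by all functions $h_A$, $A\in U$, together with all operations $g:\mathbb N^k\to\mathbb N$, $k\ge1$, such that $g(x_1,\dots,x_k)\le\max(x_1,\dots,x_k)$ for all $x_1,\dots,x_k$. \textbf{Theorem.} Assume the continuum hypothesis $2^{\aleph_0}=\aleph_1$. (1) For every countably infinite set $X$, the lattice of clones on $X$ is not dually atomic; that is, there is a clone $\mathcal C\ne\mathcal O$ on $X$ which is not contained in any precomplete clone. (2) Moreover, for $X=\mathbb N$ there is a nonprincipal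 ultrafilter $U$ on $\mathbb N$ such that $\mathcal C_U\neq\mathcal O$, the clone $\mathcal C_U$ is contained in no precomplete clone, the interval $[\mathcal C_U,\mathcal O]$ of the clone lattice is linearly ordered and has no coatom, and for every countable set $S$ of clones $\mathcal D$ with $\mathcal C_U\subseteq\mathcal D\neq\mathcal O$ there is a clone $\mathcal E\ne\mathcal O$ with $\mathcal C_U\subseteq\mathcal E$ that contains every member of $S$. -/

import Mathlib

/-- Operations on `X` of arity `n + 1`; every operation has positive arity, so there are no
nullary operations. -/
abbrev Operation (X : Type*) (n : ℕ) : Type _ := (Fin (n + 1) → X) → X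

/-- A clone on `X`: a set of finitary operations of positive arity (`ops n` is the set of its
members of arity `n + 1`) that contains all projections and is closed under composition. -/
@[ext]
structure Clone (X : Type*) where
  ops : ∀ n : ℕ, Set (Operation X n)
  proj_mem : ∀ (n : ℕ) (i : Fin (n + 1)), (fun x : Fin (n + 1) → X => x i) ∈ ops n
  comp_mem : ∀ (n m : ℕ) (f : Operation X n) (g : Fin (n + 1) → Operation X m),
    f ∈ ops n → (∀ i, g i ∈ ops m) → (fun x : Fin (m + 1) → X => f (fun i => g i x)) ∈ ops m

namespace Clone

/-- Clones are ordered by inclusion. -/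
instance (X : Type*) : PartialOrder (Clone X) where
  le C D := ∀ n, C.ops n ⊆ D.ops n
  le_refl _ _ := subset_rfl
  le_trans _ _ _ h₁ h₂ n := (h₁ n).trans (h₂ n)
  le_antisymm _ _ h₁ h₂ := Clone.ext (funext fun n => (h₁ n).antisymm (h₂ n))

/-- The infimum of a set of clones is their intersection. -/
instance (X : Type*) : InfSet (Clone X) where
  sInf S :=
    { ops := fun n => {f | ∀ C ∈ S, f ∈ C.ops n}
      proj_mem := fun n i C _ => C.proj_mem n i
      comp_mem := fun n m f g hf hg C hC =>
        C.comp_mem n m f g (hf C hC) (fun i => hg i C hC) }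

/-- The complete lattice of all clones on `X`. -/
instance (X : Type*) : CompleteLattice (Clone X) where
  __ := completeLatticeOfInf (Clone X) (fun _ =>
    ⟨fun _ hC _ _ hf => hf _ hC, fun _ hD n _ hf C hC => hD hC n hf⟩)
  top :=
    { ops := fun _ => Set.univ
      proj_mem := fun _ _ => trivial
      comp_mem := fun _ _ _ _ _ _ => trivial }
  le_top := fun _ _ _ _ => trivial

/-- The greatest clone consists of all operations. -/
theorem mem_top {X : Type*} {n : ℕ} (f : Operation X n) : f ∈ (⊤ : Clone X).ops n := trivial

/-- The order on clones is inclusion. -/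
theorem le_iff {X : Type*} {C D : Clone X} : C ≤ D ↔ ∀ n, C.ops n ⊆ D.ops n := Iff.rfl

/-- The clone generated by a set of operations. -/
def generate {X : Type*} (S : Set (Σ n, Operation X n)) : Clone X :=
  sInf {C | ∀ p ∈ S, p.2 ∈ C.ops p.1}

/-- The operations on `ℕ` bounded by the maximum of their arguments. -/
def boundedByMax : Set (Σ n, Operation ℕ n) :=
  {p | ∀ x : Fin (p.1 + 1) → ℕ, p.2 x ≤ Finset.univ.sup x}

/-- `nextIn A n` is the least element of `A` greater than `n`, for infinite `A`. -/
noncomputable def nextIn (A : Set ℕ) (n : ℕ) : ℕ := sInf {a | a ∈ A ∧ n < a}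

/-- The function `nextIn A`, as an operation of arity one. -/
noncomputable def nextInOp (A : Set ℕ) : Σ n, Operation ℕ n := ⟨0, fun x => nextIn A (x 0)⟩

/-- The clone on `ℕ` generated by all operations bounded by the maximum of their arguments,
together with the unary functions `nextIn A` for `A ∈ U`. -/
noncomputable def ofFilter (U : Filter ℕ) : Clone ℕ :=
  generate (boundedByMax ∪ {p | ∃ A ∈ U, p = nextInOp A})

end Clone

/-!
Clones on `ℕ` that contain all operations bounded by the maximum of their arguments are determined
by the unary growth rates that they contain (`hasUnary_majorant_iff`), and a growth rate `g` can
be obtained from `f` and from `nextIn A` as soon as points of `A` that are separated by one step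
of `f` are, with finitely many exceptions, also separated by one step of `g`. This relation, `Ctl
A f g`, is transitive and passes to subsets of `A`. So it suffices to find an ultrafilter `U` such
that any two growth rates are comparable by `Ctl` along a set in `U`, while every growth rate is
controlled by some `F` that, together with `nextIn A` for `A ∈ U`, does not generate everything.
Then the clones above `ofFilter U` form a chain. A bound for countably many growth rates missing
from given clones lies in a proper clone, which then contains the given clones. A coatom of the
interval would contain all growth rates, since each of them lies in some proper clone.

The ultrafilter is built in `ω₁` steps (`exists_tower`). Step `i` produces a set `A i`, almost
contained in the previous ones, and a growth rate `φ i`. The requirement to be kept is that `A i`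
is `Big`: it contains creatures for each finite set of levels up to `i`. Creatures are finite sets
built level by level: a creature with top level `i` is a long chain of creatures for the lower
levels, which are separated by `φ i`, and each of which fits into one step of `φ i`. Creatures for
two levels `j < i` show that `φ i` is not reached from `φ j` (`Big.exists_iterate_lt`). Creatures
have a Ramsey property (`Creature.exists_subset_or`), by which every subset of `ℕ` gets decided,
and a sequence of creatures for more and more levels can be fused into one big set
(`exists_isFusion`), which provides pseudo-intersections at all countable stages.

The main point is the comparison of a given growth rate `g` with the levels built so far. Take the
least level `j` such that `φ j` controls `g` along some big subset. A chain of creatures either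
has a long subchain separated by `g` or a long piece that fits into one step of `g`
(`Creature.short_or_refines`). By minimality of `j`, the first alternative is not available at the
levels below `j`, so that creatures can be chosen whose parts below level `j` fit into one step of
`g`. In their fusion `g` controls `φ j`, so `g` and `φ j` become equivalent
(`Big.equiv_or_short`). If there is no such `j`, then whole creatures fit into one step of `g`,
and `g` serves as the growth rate of a new top level (`exists_big_insert`).
-/

namespace GrowthClone

/-! ### Creatures and their Ramsey property -/

/-- The unary functions used as growth rates: monotone, and larger than the identity
everywhere. -/
def Fast (f : ℕ → ℕ) : Prop := Monotone f ∧ ∀ n, n < f n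

/-- Every point of `s` is at most `f a`, for every `a ∈ s`: seen from any of its points, the set
`s` fits into one step of `f`. -/
def Short (f : ℕ → ℕ) (s : Finset ℕ) : Prop := ∀ a ∈ s, ∀ b ∈ s, b ≤ f a

/-- The set `t` lies beyond the reach of one step of `f` from `s`. -/
def Before (f : ℕ → ℕ) (s t : Finset ℕ) : Prop := ∀ a ∈ s, ∀ b ∈ t, f a < b

/-- Creatures of width `k`, for a list of growth rates with the fastest one first. A creature for
the empty list is a singleton; a creature for `f :: L` is a union of `k` creatures for `L`, each
of them `f`-short, and separated from each other by `f` and by all members of `L`. -/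
def Creature (k : ℕ) : List (ℕ → ℕ) → Finset ℕ → Prop
  | [], s => ∃ a, s = {a}
  | f :: L, s => ∃ t : ℕ → Finset ℕ, s = (Finset.range k).biUnion t ∧
      (∀ m < k, Creature k L (t m) ∧ Short f (t m)) ∧
      ∀ m n, m < n → n < k → ∀ h ∈ f :: L, Before h (t m) (t n)

theorem Short.mono {f : ℕ → ℕ} {s t : Finset ℕ} (h : Short f s) (ht : t ⊆ s) : Short f t :=
  fun a ha b hb => h a (ht ha) b (ht hb)

theorem Before.mono {f : ℕ → ℕ} {s t s' t' : Finset ℕ} (h : Before f s t) (hs : s' ⊆ s)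
    (ht : t' ⊆ t) : Before f s' t' :=
  fun a ha b hb => h a (hs ha) b (ht hb)

theorem Creature.nonempty {k : ℕ} (hk : 1 ≤ k) :
    ∀ {L : List (ℕ → ℕ)} {s : Finset ℕ}, Creature k L s → s.Nonempty
  | [], s, ⟨a, h⟩ => by simp [h]
  | f :: L, s, ⟨t, hs, ht, _⟩ => by
    obtain ⟨a, ha⟩ := Creature.nonempty hk (ht 0 hk).1
    exact ⟨a, by rw [hs]; exact Finset.mem_biUnion.2 ⟨0, Finset.mem_range.2 hk, ha⟩⟩

/-- A creature contains a creature for every sublist of growth rates and every smaller width. -/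
theorem Creature.exists_subset {k n : ℕ} (hkn : k ≤ n) (hn : 1 ≤ n) {L L' : List (ℕ → ℕ)}
    (hL : L.Sublist L') :
    ∀ {s : Finset ℕ}, Creature n L' s → ∃ t ⊆ s, Creature k L t := by
  induction hL with
  | slnil => exact fun {s} h => ⟨s, subset_rfl, h⟩
  | cons f _ ih =>
    rintro s ⟨t, rfl, ht, -⟩
    obtain ⟨u, hu, hc⟩ := ih (ht 0 hn).1
    exact ⟨u, hu.trans (Finset.subset_biUnion_of_mem t (Finset.mem_range.2 hn)), hc⟩
  | cons_cons f hL ih =>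
    rintro s ⟨t, rfl, ht, hsep⟩
    have hex : ∀ m, ∃ u, m < n → u ⊆ t m ∧ Creature k _ u := fun m => by
      by_cases hm : m < n
      · obtain ⟨u, hu⟩ := ih (ht m hm).1
        exact ⟨u, fun _ => hu⟩
      · exact ⟨∅, fun h => absurd h hm⟩
    choose u hu using hex
    refine ⟨(Finset.range k).biUnion u, ?_, u, rfl, fun m hm => ?_, fun m m' hm hm' h hh => ?_⟩
    · intro a ha
      obtain ⟨m, hm, ham⟩ := Finset.mem_biUnion.1 ha
      have hmn := (Finset.mem_range.1 hm).trans_le hkn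
      exact Finset.mem_biUnion.2 ⟨m, Finset.mem_range.2 hmn, (hu m hmn).1 ham⟩
    · have hmn := hm.trans_le hkn
      exact ⟨(hu m hmn).2, (ht m hmn).2.mono (hu m hmn).1⟩
    · have hmn := hm'.trans_le hkn
      exact (hsep m m' hm hmn h ((hL.cons_cons f).subset hh)).mono (hu m (hm.trans hmn)).1
        (hu m' hmn).1

/-- Among `2 * k` objects of two colours there are `k` of the same colour, listed in increasing
order. -/
theorem exists_monochromatic (p : ℕ → Prop) (k : ℕ) :
    ∃ e : ℕ → ℕ, (∀ m n, m < n → n < k → e m < e n) ∧ (∀ m < k, e m < 2 * k) ∧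
      ((∀ m < k, p (e m)) ∨ ∀ m < k, ¬ p (e m)) := by
  classical
  have key : ∀ q : ℕ → Prop, k ≤ ((Finset.range (2 * k)).filter q).card →
      ∃ e : ℕ → ℕ, (∀ m n, m < n → n < k → e m < e n) ∧ (∀ m < k, e m < 2 * k) ∧
        ∀ m < k, q (e m) := by
    intro q hq
    let e := Finset.orderEmbOfCardLe _ hq
    have he : ∀ i, e i < 2 * k ∧ q (e i) := fun i => by
      have := Finset.orderEmbOfCardLe_mem _ hq i
      simpa using this
    refine ⟨fun m => if h : m < k then e ⟨m, h⟩ else 0, ?_, ?_, ?_⟩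
    · intro m n hmn hn
      have hm := hmn.trans hn
      simp only [hn, hm, dif_pos]
      exact e.strictMono hmn
    · intro m hm
      simpa only [hm, dif_pos] using (he ⟨m, hm⟩).1
    · intro m hm
      simpa only [hm, dif_pos] using (he ⟨m, hm⟩).2
  have hcard := Finset.card_filter_add_card_filter_not (s := Finset.range (2 * k)) p
  rw [Finset.card_range] at hcard
  rcases le_or_gt k ((Finset.range (2 * k)).filter p).card with h | h
  · obtain ⟨e, h1, h2, h3⟩ := key p h
    exact ⟨e, h1, h2, Or.inl h3⟩
  · have h' : k ≤ ((Finset.range (2 * k)).filter fun n => ¬ p n).card := by omega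
    obtain ⟨e, h1, h2, h3⟩ := key (fun n => ¬ p n) (by convert h')
    exact ⟨e, h1, h2, Or.inr h3⟩

/-- Creatures have the Ramsey property: if a set is split in two, then a creature of width `2 * k`
contains a creature of width `k` that lies in one of the parts. -/
theorem Creature.exists_subset_or (X : Set ℕ) {k : ℕ} {L : List (ℕ → ℕ)} :
    ∀ {s : Finset ℕ}, Creature (2 * k) L s →
      ∃ t ⊆ s, Creature k L t ∧ ((∀ a ∈ t, a ∈ X) ∨ ∀ a ∈ t, a ∉ X) := by
  induction L with
  | nil =>
    rintro s ⟨a, rfl⟩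
    exact ⟨{a}, subset_rfl, ⟨a, rfl⟩, by simpa using em (a ∈ X)⟩
  | cons f L ih =>
    rintro s ⟨t, rfl, ht, hsep⟩
    have hex : ∀ m, ∃ u, m < 2 * k → u ⊆ t m ∧ Creature k L u ∧
        ((∀ a ∈ u, a ∈ X) ∨ ∀ a ∈ u, a ∉ X) := fun m => by
      by_cases hm : m < 2 * k
      · obtain ⟨u, hu⟩ := ih (ht m hm).1
        exact ⟨u, fun _ => hu⟩
      · exact ⟨∅, fun h => absurd h hm⟩
    choose u hu using hex
    obtain ⟨e, he, hek, hc⟩ := exists_monochromatic (fun m => ∀ a ∈ u m, a ∈ X) k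
    refine ⟨(Finset.range k).biUnion (u ∘ e), ?_, ⟨u ∘ e, rfl, fun m hm => ?_,
      fun m m' hm hm' h hh => ?_⟩, ?_⟩
    · intro a ha
      obtain ⟨m, hm, ham⟩ := Finset.mem_biUnion.1 ha
      have hmn := hek m (Finset.mem_range.1 hm)
      exact Finset.mem_biUnion.2 ⟨e m, Finset.mem_range.2 hmn, (hu _ hmn).1 ham⟩
    · have hmn := hek m hm
      exact ⟨(hu _ hmn).2.1, (ht _ hmn).2.mono (hu _ hmn).1⟩
    · have hmn := hek m' hm'
      exact (hsep _ _ (he m m' hm hm') hmn h hh).mono (hu _ (hek m (hm.trans hm'))).1 (hu _ hmn).1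
    · simp only [Finset.mem_biUnion, Finset.mem_range, Function.comp]
      rcases hc with hc | hc
      · exact Or.inl fun a ⟨m, hm, ham⟩ => hc m hm a ham
      · exact Or.inr fun a ⟨m, hm, ham⟩ => ((hu _ (hek m hm)).2.2.resolve_left (hc m hm)) a ham

/-- In a creature for `H`, two points in increasing order are separated by all members of some
nonempty final segment of `H`. -/
theorem Creature.of_lt {k : ℕ} {S : ℕ → ℕ → Prop} {H : List (ℕ → ℕ)} (hH : ∀ h ∈ H, Fast h)
    (hS : ∀ f H', (f :: H') <:+ H → ∀ a b, (∀ h ∈ f :: H', h a < b) → S a b) :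
    ∀ {s : Finset ℕ}, Creature k H s → ∀ a ∈ s, ∀ b ∈ s, a < b → S a b := by
  induction H with
  | nil =>
    rintro s ⟨c, rfl⟩ a ha b hb hab
    simp only [Finset.mem_singleton] at ha hb
    omega
  | cons f H ih =>
    rintro s ⟨t, rfl, ht, hsep⟩ a ha b hb hab
    obtain ⟨m, hm, ham⟩ := Finset.mem_biUnion.1 ha
    obtain ⟨n, hn, hbn⟩ := Finset.mem_biUnion.1 hb
    rw [Finset.mem_range] at hm hn
    rcases lt_trichotomy m n with hmn | rfl | hmn
    · exact hS f H List.suffix_rfl a b fun h hh => hsep m n hmn hn h hh a ham b hbn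
    · exact ih (fun h hh => hH h (List.mem_cons_of_mem _ hh))
        (fun f' H' hf' => hS f' H' (hf'.trans (List.suffix_cons f H))) (ht m hm).1 a ham b hbn hab
    · have := hsep n m hmn hm f List.mem_cons_self b hbn a ham
      have := (hH f List.mem_cons_self).2 b
      omega

/-! ### The dichotomy for a new growth rate -/

/-- Points of `s` separated by `f` are also separated by `g`. -/
def Refines (f g : ℕ → ℕ) (s : Finset ℕ) : Prop := ∀ a ∈ s, ∀ b ∈ s, f a < b → g a < b

theorem Refines.mono {f g : ℕ → ℕ} {s t : Finset ℕ} (h : Refines f g s) (ht : t ⊆ s) :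
    Refines f g t :=
  fun a ha b hb => h a (ht ha) b (ht hb)

/-- `s` has a point beyond the reach of one step of `g` from `t`. This is what makes the
refinement property pass from the blocks of a creature to their union: consecutive blocks
are `g`-separated. -/
def Passes (g : ℕ → ℕ) (t s : Finset ℕ) : Prop := ∃ b ∈ s, ∀ a ∈ t, g a < b

theorem refines_biUnion {f f' g : ℕ → ℕ} (hf : Fast f) (hf' : Fast f') {k : ℕ} (hk : 1 ≤ k)
    {t u : ℕ → Finset ℕ} (hu : ∀ m < k, u m ⊆ t m ∧ Refines f' g (u m) ∧ Passes g (u m) (t m))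
    (hsep : ∀ m n, m < n → n < k → Before f (t m) (t n)) :
    Refines f' g ((Finset.range k).biUnion u) ∧
      Passes g ((Finset.range k).biUnion u) (t (k - 1)) := by
  have hlt : ∀ m n, m < n → n < k → ∀ a ∈ t m, ∀ b ∈ t n, a < b := fun m n hmn hn a ha b hb =>
    (hf.2 a).trans (hsep m n hmn hn a ha b hb)
  have hg : ∀ m n, m < n → n < k → ∀ a ∈ u m, ∀ b ∈ t n, g a < b := by
    intro m n hmn hn a ha b hb
    obtain ⟨c, hc, hac⟩ := (hu m (hmn.trans hn)).2.2
    exact (hac a ha).trans (hlt m n hmn hn c hc b hb)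
  refine ⟨?_, ?_⟩
  · intro a ha b hb hab
    obtain ⟨m, hm, ham⟩ := Finset.mem_biUnion.1 ha
    obtain ⟨n, hn, hbn⟩ := Finset.mem_biUnion.1 hb
    rw [Finset.mem_range] at hm hn
    rcases lt_trichotomy m n with hmn | rfl | hmn
    · exact hg m n hmn hn a ham b ((hu n hn).1 hbn)
    · exact (hu m hm).2.1 a ham b hbn hab
    · have h1 := hlt n m hmn hm b ((hu n hn).1 hbn) a ((hu m hm).1 ham)
      have h2 := hf'.2 a
      omega
  · obtain ⟨c, hc, hac⟩ := (hu (k - 1) (by omega)).2.2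
    refine ⟨c, hc, fun a ha => ?_⟩
    obtain ⟨m, hm, ham⟩ := Finset.mem_biUnion.1 ha
    rw [Finset.mem_range] at hm
    rcases lt_or_eq_of_le (Nat.le_sub_one_of_lt hm) with h | rfl
    · exact hg m (k - 1) h (by omega) a ham c hc
    · exact hac a ham

/-- The dichotomy for a single level: a wide chain of blocks contains a `g`-short piece of `k`
consecutive blocks, or else a subchain of `k` blocks that is separated by `g`. -/
theorem Creature.short_or_refines {g f : ℕ → ℕ} (hg : Fast g) (hf : Fast f) {k : ℕ} (hk : 1 ≤ k)
    (L : List (ℕ → ℕ)) {s : Finset ℕ} (hs : Creature ((k + 1) * (k + 1)) (f :: L) s) :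
    ∃ t ⊆ s, Creature k (f :: L) t ∧ ((Refines f g t ∧ Passes g t s) ∨ Short g t) := by
  have hkK : k ≤ (k + 1) * (k + 1) := by nlinarith
  obtain ⟨t, rfl, ht, hsep⟩ := hs
  have hex : ∀ m, ∃ u, m < (k + 1) * (k + 1) → u ⊆ t m ∧ Creature k L u := fun m => by
    by_cases hm : m < (k + 1) * (k + 1)
    · obtain ⟨u, hu⟩ := Creature.exists_subset hkK (hk.trans hkK) (List.Sublist.refl _) (ht m hm).1
      exact ⟨u, fun _ => hu⟩
    · exact ⟨∅, fun h => absurd h hm⟩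
  choose u hu using hex
  have hlt : ∀ m n, m < n → n < (k + 1) * (k + 1) → ∀ a ∈ u m, ∀ b ∈ u n, a < b := by
    intro m n hmn hn a ha b hb
    exact (hf.2 a).trans (hsep m n hmn hn f List.mem_cons_self a ((hu m (hmn.trans hn)).1 ha) b
      ((hu n hn).1 hb))
  have hle : ∀ m n, m ≤ n → n < (k + 1) * (k + 1) → ∀ a ∈ u m, ∃ b ∈ u n, a ≤ b := by
    intro m n hmn hn a ha
    rcases hmn.lt_or_eq with h | rfl
    · obtain ⟨b, hb⟩ := (hu n hn).2.nonempty hk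
      exact ⟨b, hb, (hlt m n h hn a ha b hb).le⟩
    · exact ⟨a, ha, le_rfl⟩
  -- Any increasing choice of `k` blocks is a creature.
  have hcr : ∀ e : ℕ → ℕ, (∀ m n, m < n → n < k → e m < e n) →
      (∀ m < k, e m < (k + 1) * (k + 1)) →
      (Finset.range k).biUnion (u ∘ e) ⊆ (Finset.range ((k + 1) * (k + 1))).biUnion t ∧
      Creature k (f :: L) ((Finset.range k).biUnion (u ∘ e)) := by
    intro e he hek
    refine ⟨fun a ha => ?_, u ∘ e, rfl, fun m hm => ?_, fun m m' hm hm' h hh => ?_⟩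
    · obtain ⟨m, hm, ham⟩ := Finset.mem_biUnion.1 ha
      have hmn := hek m (Finset.mem_range.1 hm)
      exact Finset.mem_biUnion.2 ⟨e m, Finset.mem_range.2 hmn, (hu _ hmn).1 ham⟩
    · have hmn := hek m hm
      exact ⟨(hu _ hmn).2, (ht _ hmn).2.mono (hu _ hmn).1⟩
    · have hmn := hek m' hm'
      exact (hsep _ _ (he m m' hm hm') hmn h hh).mono (hu _ (hek m (hm.trans hm'))).1 (hu _ hmn).1
  by_cases hshort : ∃ p, p + k ≤ (k + 1) * (k + 1) ∧
      Short g ((Finset.range k).biUnion (u ∘ fun m => p + m))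
  · obtain ⟨p, hp, hsh⟩ := hshort
    obtain ⟨h1, h2⟩ := hcr (fun m => p + m) (fun m n h _ => by omega)
      (fun m h => by omega)
    exact ⟨_, h1, h2, Or.inr hsh⟩
  -- Otherwise one step of `g` does not get across any `k` consecutive blocks.
  have hjump : ∀ p q r, q < p → p + k ≤ r → r < (k + 1) * (k + 1) →
      ∀ x ∈ u q, ∀ c ∈ u r, g x < c := by
    intro p q r hqp hpr hr x hx c hc
    have hnot : ¬ Short g ((Finset.range k).biUnion (u ∘ fun m => p + m)) :=
      fun h => hshort ⟨p, by omega, h⟩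
    simp only [Short, not_forall, not_le] at hnot
    obtain ⟨a, ha, b, hb, hab⟩ := hnot
    obtain ⟨m, hm, ham⟩ := Finset.mem_biUnion.1 ha
    obtain ⟨n, hn, hbn⟩ := Finset.mem_biUnion.1 hb
    rw [Finset.mem_range] at hm hn
    have h1 := hlt q (p + m) (by omega) (by omega) x hx a ham
    have h2 := hlt (p + n) r (by omega) hr b hbn c hc
    have h3 := hg.1 h1.le
    omega
  have hmul : ∀ m ≤ k, (k + 1) * m < (k + 1) * (k + 1) := fun m hm => by nlinarith
  obtain ⟨h1, h2⟩ := hcr (fun m => (k + 1) * m) (fun m n h _ => by nlinarith)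
    (fun m h => hmul m h.le)
  have hnext : ∀ m n, m < n → n ≤ k → ∀ x ∈ u ((k + 1) * m), ∀ c ∈ u ((k + 1) * n), g x < c := by
    intro m n hmn hn
    refine hjump ((k + 1) * m + 1) _ _ (Nat.lt_succ_self _) ?_ (hmul n hn)
    calc (k + 1) * m + 1 + k = (k + 1) * (m + 1) := by ring
      _ ≤ (k + 1) * n := Nat.mul_le_mul_left _ hmn
  refine ⟨_, h1, h2, Or.inl ⟨?_, ?_⟩⟩
  · intro a ha b hb hab
    obtain ⟨m, hm, ham⟩ := Finset.mem_biUnion.1 ha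
    obtain ⟨n, hn, hbn⟩ := Finset.mem_biUnion.1 hb
    rw [Finset.mem_range] at hm hn
    rcases lt_trichotomy m n with hmn | rfl | hmn
    · exact hnext m n hmn hn.le a ham b hbn
    · -- a single block is `f`-short
      have := (ht _ (hmul m hm.le)).2 a ((hu _ (hmul m hm.le)).1 ham) b
        ((hu _ (hmul m hm.le)).1 hbn)
      omega
    · have h3 := hlt ((k + 1) * n) ((k + 1) * m) (by nlinarith) (hmul m hm.le) b hbn a ham
      have h4 := hf.2 a
      omega
  · obtain ⟨b, hb⟩ := (hu _ (hmul k le_rfl)).2.nonempty hk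
    refine ⟨b, Finset.mem_biUnion.2 ⟨_, Finset.mem_range.2 (hmul k le_rfl),
      (hu _ (hmul k le_rfl)).1 hb⟩, fun a ha => ?_⟩
    obtain ⟨m, hm, ham⟩ := Finset.mem_biUnion.1 ha
    exact hnext m k (Finset.mem_range.1 hm) le_rfl a ham b hb

/-- The dichotomy for creatures with the levels `H ++ f :: L`: a wide enough creature contains one
on which `g` is bounded by `f` in the sense of `Refines f g`, or one, perhaps with some
levels of `H` dropped, on which points separated by `g` belong to different blocks of the
remaining levels of `H`. -/
theorem Creature.refines_or {g f : ℕ → ℕ} (hg : Fast g) (hf : Fast f) (L : List (ℕ → ℕ))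
    {k : ℕ} (hk : 1 ≤ k) {H' H : List (ℕ → ℕ)} (hsub : H'.Sublist H) {S : ℕ → ℕ → Prop}
    (hH : ∀ h ∈ H, Fast h)
    (hS : ∀ h H₁, (h :: H₁) <:+ H' → ∀ a b, (∀ i ∈ h :: H₁, i a < b) → S a b) :
    ∃ K, ∀ s, Creature K (H ++ f :: L) s → ∃ t ⊆ s,
      (Creature k (H ++ f :: L) t ∧ Refines f g t ∧ Passes g t s) ∨
      (Creature k (H' ++ f :: L) t ∧ ∀ a ∈ t, ∀ b ∈ t, g a < b → S a b) := by
  induction hsub with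
  | slnil =>
    refine ⟨(k + 1) * (k + 1), fun s hs => ?_⟩
    obtain ⟨t, hts, hc, h | h⟩ := Creature.short_or_refines hg hf hk L hs
    · exact ⟨t, hts, Or.inl ⟨hc, h⟩⟩
    · exact ⟨t, hts, Or.inr ⟨hc, fun a ha b hb hab => absurd hab (h a ha b hb).not_gt⟩⟩
  | @cons H' H h hsub ih =>
    obtain ⟨K₀, hK₀⟩ := ih (fun i hi => hH i (List.mem_cons_of_mem _ hi)) hS
    refine ⟨max K₀ k, ?_⟩
    rintro s ⟨t, rfl, ht, hsep⟩
    have hfast := hH h List.mem_cons_self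
    have hkK : k ≤ max K₀ k := le_max_right _ _
    have hex : ∀ m, ∃ u, m < k → u ⊆ t m ∧
        ((Creature k (H ++ f :: L) u ∧ Refines f g u ∧ Passes g u (t m)) ∨
        (Creature k (H' ++ f :: L) u ∧ ∀ a ∈ u, ∀ b ∈ u, g a < b → S a b)) := fun m => by
      by_cases hm : m < k
      · obtain ⟨v, hv, hcv⟩ := Creature.exists_subset (le_max_left K₀ k) (hk.trans hkK)
          (List.Sublist.refl _) (ht m (hm.trans_le hkK)).1
        obtain ⟨u, hu, h1 | h1⟩ := hK₀ v hcv
        · obtain ⟨h1, h2, c, hc, h3⟩ := h1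
          exact ⟨u, fun _ => ⟨hu.trans hv, Or.inl ⟨h1, h2, c, hv hc, h3⟩⟩⟩
        · exact ⟨u, fun _ => ⟨hu.trans hv, Or.inr h1⟩⟩
      · exact ⟨∅, fun h => absurd h hm⟩
    choose u hu using hex
    by_cases hall : ∃ m < k, Creature k (H' ++ f :: L) (u m) ∧
        ∀ a ∈ u m, ∀ b ∈ u m, g a < b → S a b
    · obtain ⟨m, hm, h1⟩ := hall
      exact ⟨u m, (hu m hm).1.trans (Finset.subset_biUnion_of_mem t
        (Finset.mem_range.2 (hm.trans_le hkK))), Or.inr h1⟩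
    · have hu' := fun m (hm : m < k) => (hu m hm).2.resolve_right fun h1 => hall ⟨m, hm, h1⟩
      obtain ⟨h1, c, hc, h2⟩ := refines_biUnion hfast hf hk
        (fun m hm => ⟨(hu m hm).1, (hu' m hm).2⟩)
        (fun m n hmn hn => hsep m n hmn (hn.trans_le hkK) h List.mem_cons_self)
      refine ⟨(Finset.range k).biUnion u, ?_, Or.inl ⟨⟨u, rfl, fun m hm => ?_,
        fun m n hm hn i hi => ?_⟩, h1, c, ?_, h2⟩⟩
      · intro a ha
        obtain ⟨m, hm, ham⟩ := Finset.mem_biUnion.1 ha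
        rw [Finset.mem_range] at hm
        exact Finset.mem_biUnion.2 ⟨m, Finset.mem_range.2 (hm.trans_le hkK), (hu m hm).1 ham⟩
      · exact ⟨(hu' m hm).1, (ht m (hm.trans_le hkK)).2.mono (hu m hm).1⟩
      · exact (hsep m n hm (hn.trans_le hkK) i hi).mono (hu m (hm.trans hn)).1 (hu n hn).1
      · exact Finset.mem_biUnion.2 ⟨k - 1, Finset.mem_range.2 (by omega), hc⟩
  | @cons_cons H' H h hsub ih =>
    obtain ⟨K₀, hK₀⟩ := ih (fun i hi => hH i (List.mem_cons_of_mem _ hi))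
      (fun i H₁ hi => hS i H₁ (hi.trans (List.suffix_cons h H')))
    refine ⟨max K₀ (2 * k), ?_⟩
    rintro s ⟨t, rfl, ht, hsep⟩
    have hfast := hH h List.mem_cons_self
    have hkK : 2 * k ≤ max K₀ (2 * k) := le_max_right _ _
    have hex : ∀ m, ∃ u, m < 2 * k → u ⊆ t m ∧
        ((Creature k (H ++ f :: L) u ∧ Refines f g u ∧ Passes g u (t m)) ∨
        (Creature k (H' ++ f :: L) u ∧ ∀ a ∈ u, ∀ b ∈ u, g a < b → S a b)) := fun m => by
      by_cases hm : m < 2 * k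
      · obtain ⟨v, hv, hcv⟩ := Creature.exists_subset (le_max_left K₀ (2 * k)) (by omega)
          (List.Sublist.refl _) (ht m (hm.trans_le hkK)).1
        obtain ⟨u, hu, h1 | h1⟩ := hK₀ v hcv
        · obtain ⟨h1, h2, c, hc, h3⟩ := h1
          exact ⟨u, fun _ => ⟨hu.trans hv, Or.inl ⟨h1, h2, c, hv hc, h3⟩⟩⟩
        · exact ⟨u, fun _ => ⟨hu.trans hv, Or.inr h1⟩⟩
      · exact ⟨∅, fun h => absurd h hm⟩
    choose u hu using hex
    obtain ⟨e, he, hek, hc⟩ := exists_monochromatic (fun m =>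
      Creature k (H' ++ f :: L) (u m) ∧ ∀ a ∈ u m, ∀ b ∈ u m, g a < b → S a b) k
    have hsub' : (Finset.range k).biUnion (u ∘ e) ⊆
        (Finset.range (max K₀ (2 * k))).biUnion t := by
      intro a ha
      obtain ⟨m, hm, ham⟩ := Finset.mem_biUnion.1 ha
      have hm' := hek m (Finset.mem_range.1 hm)
      exact Finset.mem_biUnion.2 ⟨e m, Finset.mem_range.2 (hm'.trans_le hkK), (hu _ hm').1 ham⟩
    have hsepu : ∀ m n, m < n → n < k → ∀ i ∈ h :: (H ++ f :: L), Before i (u (e m)) (u (e n)) :=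
      fun m n hmn hn i hi => (hsep _ _ (he m n hmn hn) ((hek n hn).trans_le hkK) i hi).mono
        (hu _ (hek m (hmn.trans hn))).1 (hu _ (hek n hn)).1
    have hshort : ∀ m < k, Short h (u (e m)) := fun m hm =>
      (ht _ ((hek m hm).trans_le hkK)).2.mono (hu _ (hek m hm)).1
    rcases hc with hc | hc
    · have hsubl : ∀ i ∈ h :: (H' ++ f :: L), i ∈ h :: (H ++ f :: L) :=
        ((hsub.append_right (f :: L)).cons_cons h).subset
      refine ⟨_, hsub', Or.inr ⟨⟨u ∘ e, rfl, fun m hm => ⟨(hc m hm).1, hshort m hm⟩,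
        fun m n hm hn i hi => hsepu m n hm hn i (hsubl i hi)⟩, ?_⟩⟩
      intro a ha b hb hab
      obtain ⟨m, hm, ham⟩ := Finset.mem_biUnion.1 ha
      obtain ⟨n, hn, hbn⟩ := Finset.mem_biUnion.1 hb
      rw [Finset.mem_range] at hm hn
      rcases lt_trichotomy m n with hmn | rfl | hmn
      · refine hS h H' List.suffix_rfl a b fun i hi => ?_
        exact hsepu m n hmn hn i (hsubl i (List.mem_append_left (f :: L) hi)) a ham b hbn
      · exact (hc m hm).2 a ham b hbn hab
      · have h1 := hsepu n m hmn hm h List.mem_cons_self b hbn a ham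
        have h2 := hfast.2 b
        have h3 := hg.2 a
        omega
    · have hu' := fun m (hm : m < k) => (hu _ (hek m hm)).2.resolve_right (hc m hm)
      obtain ⟨h1, c, hc, h2⟩ := refines_biUnion (t := t ∘ e) (u := u ∘ e) hfast hf hk
        (fun m hm => ⟨(hu _ (hek m hm)).1, (hu' m hm).2⟩)
        (fun m n hmn hn => hsep _ _ (he m n hmn hn) ((hek n hn).trans_le hkK) h
          List.mem_cons_self)
      refine ⟨_, hsub', Or.inl ⟨⟨u ∘ e, rfl, fun m hm => ⟨(hu' m hm).1, hshort m hm⟩,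
        fun m n hm hn i hi => hsepu m n hm hn i hi⟩, h1, c, ?_, h2⟩⟩
      exact Finset.mem_biUnion.2 ⟨e (k - 1),
        Finset.mem_range.2 ((hek _ (by omega)).trans_le hkK), hc⟩

/-! ### Big sets and fusion -/

section

variable {I : Type*} [LinearOrder I]

/-- `A` is big for the levels in `J` with growth rates `φ`: arbitrarily far out, `A` contains
creatures of every width for every finite set of levels from `J`. The finite set is given as
a strictly decreasing list. -/
def Big (φ : I → ℕ → ℕ) (J : Set I) (A : Set ℕ) : Prop :=
  ∀ L : List I, L.Pairwise (· > ·) → (∀ i ∈ L, i ∈ J) → ∀ k N : ℕ,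
    ∃ s : Finset ℕ, (∀ a ∈ s, N ≤ a) ∧ Creature k (L.map φ) s ∧ ↑s ⊆ A

/-- `f` controls `g` along `A`: with finitely many exceptions, points of `A` separated by `f` are
also separated by `g`. In the presence of `nextIn A` this makes `g` obtainable from `f`. -/
def Ctl (A : Set ℕ) (f g : ℕ → ℕ) : Prop :=
  ∃ N, ∀ a ∈ A, N ≤ a → ∀ b ∈ A, f a < b → g a < b

theorem Ctl.refl (A : Set ℕ) (f : ℕ → ℕ) : Ctl A f f := ⟨0, fun _ _ _ _ _ h => h⟩

theorem Ctl.trans {A : Set ℕ} {f g h : ℕ → ℕ} (h₁ : Ctl A f g) (h₂ : Ctl A g h) : Ctl A f h := by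
  obtain ⟨M, hM⟩ := h₁
  obtain ⟨N, hN⟩ := h₂
  exact ⟨max M N, fun a ha hMN b hb hab => hN a ha ((le_max_right _ _).trans hMN) b hb
    (hM a ha ((le_max_left _ _).trans hMN) b hb hab)⟩

theorem Ctl.mono {A B : Set ℕ} {f g : ℕ → ℕ} (h : Ctl A f g) (hBA : B ⊆ A) : Ctl B f g := by
  obtain ⟨M, hM⟩ := h
  exact ⟨M, fun a ha hMa b hb hab => hM a (hBA ha) hMa b (hBA hb) hab⟩

theorem Big.congr {φ ψ : I → ℕ → ℕ} {J : Set I} {A : Set ℕ} (h : Big φ J A)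
    (hφ : ∀ j ∈ J, φ j = ψ j) : Big ψ J A := fun L hL hLJ k N => by
  obtain ⟨s, h1, h2, h3⟩ := h L hL hLJ k N
  have : L.map φ = L.map ψ := List.map_congr_left fun j hj => hφ j (hLJ j hj)
  exact ⟨s, h1, this ▸ h2, h3⟩

theorem sublist_of_decreasing {L L' : List I} (hL : L.Pairwise (· > ·))
    (hL' : L'.Pairwise (· > ·)) (h : ∀ i ∈ L, i ∈ L') : L.Sublist L' :=
  List.sublist_of_subperm_of_pairwise (r := (· > ·))
    ((show L.Nodup from hL.imp fun h => ne_of_gt h).subperm h) hL hL'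

/-- Finitely many levels, listed in decreasing order. -/
theorem exists_decreasing (E : Finset I) :
    ∃ L : List I, L.Pairwise (· > ·) ∧ ∀ i, i ∈ L ↔ i ∈ E :=
  ⟨E.sort (· ≥ ·), (Finset.sortedGT_sort E).pairwise, fun _ => Finset.mem_sort _⟩

theorem exists_decreasing_union (L L' : List I) :
    ∃ M : List I, M.Pairwise (· > ·) ∧ ∀ i, i ∈ M ↔ i ∈ L ∨ i ∈ L' := by
  obtain ⟨M, h1, h2⟩ := exists_decreasing (L.toFinset ∪ L'.toFinset)
  exact ⟨M, h1, fun i => by simp [h2]⟩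

/-- A sequence of creatures `s n` for finite sets `L n` of levels that exhaust `J`, of widths
`w n` tending to infinity, all with the property `P`, and such that each `s n` is separated from
all later creatures by `g` and by the growth rates of the levels in `L n`. -/
structure IsFusion (φ : I → ℕ → ℕ) (J : Set I) (g : ℕ → ℕ) (P : List I → Finset ℕ → Prop)
    (L : ℕ → List I) (w : ℕ → ℕ) (s : ℕ → Finset ℕ) : Prop where
  decreasing : ∀ n, (L n).Pairwise (· > ·)
  mem_of_mem : ∀ n, ∀ i ∈ L n, i ∈ J
  exhausts : ∀ j ∈ J, ∀ᶠ n in Filter.atTop, j ∈ L n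
  le_width : ∀ n, n ≤ w n
  creature : ∀ n, Creature (w n) ((L n).map φ) (s n)
  prop : ∀ n, P (L n) (s n)
  le_of_mem : ∀ n, ∀ a ∈ s n, n ≤ a
  separated : ∀ m n, m < n → ∀ a ∈ s m, ∀ b ∈ s n, g a < b ∧ ∀ j ∈ L m, φ j a < b

theorem exists_isFusion {φ : I → ℕ → ℕ} {J : Set I} (hJ : J.Countable) (g : ℕ → ℕ)
    {P : List I → Finset ℕ → Prop}
    (h : ∀ L : List I, L.Pairwise (· > ·) → (∀ i ∈ L, i ∈ J) → ∀ k N : ℕ,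
      ∃ s : Finset ℕ, (∀ a ∈ s, N ≤ a) ∧ Creature k (L.map φ) s ∧ P L s) :
    ∃ L w s, IsFusion φ J g P L w s := by
  classical
  obtain ⟨E, hE, hEJ, hEm⟩ : ∃ E : ℕ → Finset I, Monotone E ∧ (∀ n, ∀ i ∈ E n, i ∈ J) ∧
      ∀ j ∈ J, ∃ n, j ∈ E n := by
    rcases J.eq_empty_or_nonempty with rfl | hne
    · exact ⟨fun _ => ∅, monotone_const, by simp, by simp⟩
    · obtain ⟨f, rfl⟩ := hJ.exists_eq_range hne
      refine ⟨fun n => (Finset.range n).image f, fun m n hmn => ?_, by simp, ?_⟩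
      · exact Finset.image_subset_image (Finset.range_mono hmn)
      · rintro _ ⟨n, rfl⟩
        exact ⟨n + 1, Finset.mem_image_of_mem f (by simp)⟩
  choose L hLdec hLmem using fun n => exists_decreasing (E n)
  have hLJ : ∀ n, ∀ i ∈ L n, i ∈ J := fun n i hi => hEJ n i ((hLmem n i).1 hi)
  obtain ⟨F, hF, hsep⟩ := exists_seq_of_forall_finset_exists
    (fun x : ℕ × Finset ℕ => Creature x.1 ((L x.1).map φ) x.2 ∧ P (L x.1) x.2 ∧
      ∀ a ∈ x.2, x.1 ≤ a)
    (fun x y => x.1 < y.1 ∧ ∀ a ∈ x.2, ∀ b ∈ y.2, g a < b ∧ ∀ j ∈ L x.1, φ j a < b) (by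
      intro u _
      let i := u.sup Prod.fst + 1
      let N := u.sup fun x => x.2.sup fun a => max (g a) ((E x.1).sup fun j => φ j a)
      obtain ⟨s, h1, h2, h3⟩ := h (L i) (hLdec i) (hLJ i) i (max i (N + 1))
      refine ⟨(i, s), ⟨h2, h3, fun a ha => (le_max_left _ _).trans (h1 a ha)⟩, fun x hx =>
        ⟨Nat.lt_succ_of_le (Finset.le_sup (f := Prod.fst) hx), fun a ha b hb => ?_⟩⟩
      have hb' : N < b := (le_max_right i (N + 1)).trans (h1 b hb)
      have hxN : max (g a) ((E x.1).sup fun j => φ j a) ≤ N :=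
        (Finset.le_sup (f := fun a => max (g a) ((E x.1).sup fun j => φ j a)) ha).trans
          (Finset.le_sup (f := fun x : ℕ × Finset ℕ =>
            x.2.sup fun a => max (g a) ((E x.1).sup fun j => φ j a)) hx)
      refine ⟨((le_max_left _ _).trans hxN).trans_lt hb', fun j hj => ?_⟩
      exact ((Finset.le_sup (f := fun j => φ j a) ((hLmem _ _).1 hj)).trans
        ((le_max_right _ _).trans hxN)).trans_lt hb')
  have hmono : StrictMono fun n => (F n).1 := fun m n hmn => (hsep m n hmn).1
  refine ⟨fun n => L (F n).1, fun n => (F n).1, fun n => (F n).2, fun n => hLdec _,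
    fun n => hLJ _, fun j hj => ?_, fun _ => hmono.le_apply, fun n => (hF n).1, fun n => (hF n).2.1,
    fun n a ha => (hmono.le_apply).trans ((hF n).2.2 a ha), fun m n hmn => (hsep m n hmn).2⟩
  obtain ⟨n, hn⟩ := hEm j hj
  exact Filter.eventually_atTop.2 ⟨n, fun m hm =>
    (hLmem _ _).2 (hE (hm.trans hmono.le_apply) hn)⟩

namespace IsFusion

variable {φ : I → ℕ → ℕ} {J : Set I} {g : ℕ → ℕ} {P : List I → Finset ℕ → Prop}
  {L : ℕ → List I} {w : ℕ → ℕ} {s : ℕ → Finset ℕ}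

theorem eventually_exists_subset (h : IsFusion φ J g P L w s) {M : List I}
    (hM : M.Pairwise (· > ·)) (hMJ : ∀ i ∈ M, i ∈ J) (k : ℕ) :
    ∀ᶠ n in Filter.atTop, ∃ t ⊆ s n, Creature k (M.map φ) t := by
  have hall : ∀ᶠ n in Filter.atTop, ∀ i ∈ {i | i ∈ M}, i ∈ L n :=
    (Filter.eventually_all_finite (List.finite_toSet M)).2 fun i hi => h.exhausts i (hMJ i hi)
  filter_upwards [hall, Filter.eventually_ge_atTop (max k 1)] with n h1 h2
  have h3 := h2.trans (h.le_width n)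
  exact Creature.exists_subset ((le_max_left _ _).trans h3) ((le_max_right _ _).trans h3)
    ((sublist_of_decreasing hM (h.decreasing n) h1).map φ) (h.creature n)

theorem big (h : IsFusion φ J g P L w s) : Big φ J (⋃ n, (s n : Set ℕ)) := by
  intro M hM hMJ k N
  obtain ⟨n, ⟨t, hts, ht⟩, hn⟩ := ((h.eventually_exists_subset hM hMJ k).and
    (Filter.eventually_ge_atTop N)).exists
  exact ⟨t, fun a ha => hn.trans (h.le_of_mem n a (hts ha)), ht,
    fun a ha => Set.mem_iUnion.2 ⟨n, hts ha⟩⟩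

theorem ctl (h : IsFusion φ J g P L w s) (hg : ∀ n, n < g n) {f f' : ℕ → ℕ} (hf : ∀ n, n < f n)
    (h₁ : ∀ᶠ n in Filter.atTop, Refines f f' (s n))
    (h₂ : ∀ᶠ m in Filter.atTop, ∀ n, m < n → ∀ a ∈ s m, ∀ b ∈ s n, f' a < b) :
    Ctl (⋃ n, (s n : Set ℕ)) f f' := by
  obtain ⟨n₀, hn₀⟩ := Filter.eventually_atTop.1 (h₁.and h₂)
  refine ⟨((Finset.range n₀).biUnion s).sup id + 1, fun a ha hN b hb hab => ?_⟩
  obtain ⟨m, ham⟩ := Set.mem_iUnion.1 ha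
  obtain ⟨n, hbn⟩ := Set.mem_iUnion.1 hb
  have hm : n₀ ≤ m := by
    by_contra hlt
    have : a ∈ (Finset.range n₀).biUnion s :=
      Finset.mem_biUnion.2 ⟨m, Finset.mem_range.2 (not_le.1 hlt), ham⟩
    have := Finset.le_sup (f := id) this
    simp only [id] at this
    omega
  rcases lt_trichotomy m n with hmn | rfl | hmn
  · exact (hn₀ m hm).2 n hmn a ham b hbn
  · exact (hn₀ m hm).1 a ham b hbn hab
  · have h1 := (h.separated n m hmn b hbn a ham).1
    have h2 := hg b
    have h3 := hf a
    omega

theorem separated_level (h : IsFusion φ J g P L w s) {j : I} (hj : j ∈ J) :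
    ∀ᶠ m in Filter.atTop, ∀ n, m < n → ∀ a ∈ s m, ∀ b ∈ s n, φ j a < b :=
  (h.exhausts j hj).mono fun m hm n hmn a ha b hb => (h.separated m n hmn a ha b hb).2 j hm

end IsFusion

/-- Bigness has the Ramsey property. -/
theorem Big.inter_or_diff {φ : I → ℕ → ℕ} {J : Set I} {A : Set ℕ} (h : Big φ J A) (X : Set ℕ) :
    Big φ J (A ∩ X) ∨ Big φ J (A \ X) := by
  by_contra hcon
  simp only [Big, not_or, not_forall] at hcon
  obtain ⟨⟨L₁, hL₁, hLJ₁, k₁, N₁, h₁⟩, L₂, hL₂, hLJ₂, k₂, N₂, h₂⟩ := hcon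
  obtain ⟨L, hL, hLm⟩ := exists_decreasing_union L₁ L₂
  obtain ⟨s, hsN, hs, hsA⟩ := h L hL
    (fun i hi => ((hLm i).1 hi).elim (hLJ₁ i) (hLJ₂ i)) (2 * max (max k₁ k₂) 1) (max N₁ N₂)
  obtain ⟨t, hts, ht, htX⟩ := Creature.exists_subset_or X hs
  have h1 : 1 ≤ max (max k₁ k₂) 1 := le_max_right _ _
  rcases htX with htX | htX
  · obtain ⟨u, hut, hu⟩ := Creature.exists_subset (by omega : k₁ ≤ max (max k₁ k₂) 1) h1
      ((sublist_of_decreasing hL₁ hL fun i hi => (hLm i).2 (Or.inl hi)).map φ) ht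
    exact h₁ ⟨u, fun a ha => (le_max_left _ _).trans (hsN a (hts (hut ha))), hu,
      fun a ha => ⟨hsA (hts (hut ha)), htX a (hut ha)⟩⟩
  · obtain ⟨u, hut, hu⟩ := Creature.exists_subset (by omega : k₂ ≤ max (max k₁ k₂) 1) h1
      ((sublist_of_decreasing hL₂ hL fun i hi => (hLm i).2 (Or.inr hi)).map φ) ht
    exact h₂ ⟨u, fun a ha => (le_max_right _ _).trans (hsN a (hts (hut ha))), hu,
      fun a ha => ⟨hsA (hts (hut ha)), htX a (hut ha)⟩⟩

/-- A decreasing family of big sets, indexed by a countable initial segment, has a big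
pseudo-intersection. -/
theorem exists_big_pseudoInter {φ : I → ℕ → ℕ} {i : I} (hi : (Set.Iio i).Countable)
    {A : I → Set ℕ} (hA : ∀ j < i, Big φ (Set.Iic j) (A j))
    (hdec : ∀ j < i, ∀ l < j, (A j \ A l).Finite) :
    ∃ B, Big φ (Set.Iio i) B ∧ ∀ j < i, (B \ A j).Finite := by
  obtain ⟨L, w, s, hs⟩ := exists_isFusion (φ := φ) hi id
    (P := fun L s => ∀ j ∈ L, (s : Set ℕ) ⊆ A j) (by
      intro L hL hLi k N
      cases L with
      | nil => exact ⟨{N}, by simp, ⟨N, rfl⟩, by simp⟩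
      | cons j L =>
        have hj : j < i := hLi j List.mem_cons_self
        have hlt : ∀ l ∈ L, l < j := (List.pairwise_cons.1 hL).1
        -- all the finitely many exceptional points lie below `M`
        obtain ⟨M, hM⟩ : ∃ M, ∀ l ∈ L, ∀ a ∈ A j \ A l, a ≤ M := by
          have hfin : (⋃ l ∈ {l | l ∈ L}, A j \ A l).Finite :=
            (List.finite_toSet L).biUnion fun l hl => hdec j hj l (hlt l hl)
          obtain ⟨M, hM⟩ := hfin.bddAbove
          exact ⟨M, fun l hl a ha => hM (Set.mem_biUnion (show l ∈ {l | l ∈ L} from hl) ha)⟩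
        obtain ⟨s, h1, h2, h3⟩ := hA j hj (j :: L) hL (fun l hl => by
          rcases List.mem_cons.1 hl with rfl | hl
          · exact le_rfl
          · exact (hlt l hl).le) k (max N (M + 1))
        refine ⟨s, fun a ha => (le_max_left _ _).trans (h1 a ha), h2, fun l hl => ?_⟩
        rcases List.mem_cons.1 hl with rfl | hl
        · exact h3
        · intro a ha
          by_contra hal
          have h4 := hM l hl a ⟨h3 ha, hal⟩
          have h5 := (le_max_right N (M + 1)).trans (h1 a ha)
          omega)
  refine ⟨_, hs.big, fun j hj => ?_⟩
  obtain ⟨n₀, hn₀⟩ := Filter.eventually_atTop.1 (hs.exhausts j hj)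
  refine ((Finset.range n₀).biUnion s).finite_toSet.subset ?_
  rintro a ⟨ha, haj⟩
  obtain ⟨n, han⟩ := Set.mem_iUnion.1 ha
  refine Finset.mem_coe.2 (Finset.mem_biUnion.2 ⟨n, Finset.mem_range.2 ?_, han⟩)
  by_contra hn
  exact haj (hs.prop n j (hn₀ n (not_lt.1 hn)) han)

/-- A growth rate so large that it makes arbitrary creatures of `A` short. -/
theorem Big.exists_short {φ : I → ℕ → ℕ} {J : Set I} (hJ : J.Countable) {A : Set ℕ}
    (h : Big φ J A) : ∃ ψ, Fast ψ ∧ ∀ L : List I, L.Pairwise (· > ·) → (∀ i ∈ L, i ∈ J) →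
      ∀ k N : ℕ, ∃ s : Finset ℕ, (∀ a ∈ s, N ≤ a) ∧ Creature k (L.map φ) s ∧ ↑s ⊆ A ∧
        Short ψ s := by
  obtain ⟨L, w, s, hs⟩ := exists_isFusion (φ := φ) hJ id (P := fun _ s => (s : Set ℕ) ⊆ A) h
  have hmono : Monotone fun n => (Finset.range (n + 1)).sup fun m => (s m).sup id :=
    fun m n hmn => Finset.sup_mono (Finset.range_mono (Nat.succ_le_succ hmn))
  refine ⟨fun n => n + 1 + (Finset.range (n + 1)).sup fun m => (s m).sup id,
    ⟨fun m n hmn => ?_, fun n => by dsimp only; omega⟩, fun M hM hMJ k N => ?_⟩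
  · have := hmono hmn
    dsimp only at this ⊢
    omega
  obtain ⟨n, ⟨t, hts, ht⟩, hn⟩ := ((hs.eventually_exists_subset hM hMJ k).and
    (Filter.eventually_ge_atTop N)).exists
  refine ⟨t, fun a ha => hn.trans (hs.le_of_mem n a (hts ha)), ht,
    fun a ha => hs.prop n (hts ha), fun a ha b hb => ?_⟩
  have h1 : b ≤ (s n).sup id := Finset.le_sup (f := id) (hts hb)
  have h2 : (s n).sup id ≤ (Finset.range (a + 1)).sup fun m => (s m).sup id :=
    Finset.le_sup (f := fun m => (s m).sup id)
      (Finset.mem_range.2 (Nat.lt_succ_of_le (hs.le_of_mem n a (hts ha))))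
  dsimp only
  omega

/-- If creatures can be chosen short for the growth rate of a new top level `i`, then the set can
be thinned out so that it is big with the new level included, and so that the new growth rate
controls all the old ones. -/
theorem exists_big_insert {φ : I → ℕ → ℕ} {J : Set I} (hJ : J.Countable) {i : I}
    (hi : ∀ j ∈ J, j < i) (hφi : Fast (φ i)) {A : Set ℕ}
    (h : ∀ L : List I, L.Pairwise (· > ·) → (∀ i ∈ L, i ∈ J) →
      ∀ k N : ℕ, ∃ s : Finset ℕ, (∀ a ∈ s, N ≤ a) ∧ Creature k (L.map φ) s ∧ ↑s ⊆ A ∧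
        Short (φ i) s) :
    ∃ B ⊆ A, Big φ (insert i J) B ∧ ∀ j ∈ J, Ctl B (φ i) (φ j) := by
  obtain ⟨L, w, s, hs⟩ := exists_isFusion (φ := φ) hJ (φ i)
    (P := fun _ s => (s : Set ℕ) ⊆ A ∧ Short (φ i) s) h
  refine ⟨⋃ n, (s n : Set ℕ), Set.iUnion_subset fun n => (hs.prop n).1, ?_, fun j hj => ?_⟩
  · intro M hM hMJ k N
    cases M with
    | nil => exact hs.big [] hM (by simp) k N
    | cons j M =>
      rcases hMJ j List.mem_cons_self with rfl | hj
      · have hlt : ∀ l ∈ M, l < j := (List.pairwise_cons.1 hM).1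
        have hMJ' : ∀ l ∈ M, l ∈ J := fun l hl =>
          (hMJ l (List.mem_cons_of_mem _ hl)).resolve_left (hlt l hl).ne
        have hsepM : ∀ᶠ n in Filter.atTop, ∀ l ∈ {l | l ∈ M}, l ∈ L n :=
          (Filter.eventually_all_finite (List.finite_toSet M)).2
            fun l hl => hs.exhausts l (hMJ' l hl)
        obtain ⟨n₀, hn₀⟩ := Filter.eventually_atTop.1
          ((hs.eventually_exists_subset (List.pairwise_cons.1 hM).2 hMJ' k).and hsepM)
        choose t hts ht using fun m =>
          (hn₀ (max n₀ N + m) ((le_max_left _ _).trans (Nat.le_add_right _ _))).1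
        refine ⟨(Finset.range k).biUnion t, fun a ha => ?_, ⟨t, rfl, fun m _ =>
          ⟨ht m, (hs.prop _).2.mono (hts m)⟩, fun m n hmn _ f hf a ha b hb => ?_⟩, fun a ha => ?_⟩
        · obtain ⟨m, -, ham⟩ := Finset.mem_biUnion.1 ha
          exact ((le_max_right n₀ N).trans (Nat.le_add_right _ _)).trans
            (hs.le_of_mem _ a (hts m ham))
        · have hsep := hs.separated _ _ (Nat.add_lt_add_left hmn (max n₀ N)) a (hts m ha) b
            (hts n hb)
          rcases List.mem_cons.1 hf with rfl | hf
          · exact hsep.1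
          · obtain ⟨l, hl, rfl⟩ := List.mem_map.1 hf
            exact hsep.2 l
              ((hn₀ _ ((le_max_left _ _).trans (Nat.le_add_right _ _))).2 l hl)
        · obtain ⟨m, -, ham⟩ := Finset.mem_biUnion.1 (Finset.mem_coe.1 ha)
          exact Set.mem_iUnion.2 ⟨_, hts m ham⟩
      · refine hs.big (j :: M) hM (fun l hl => (hMJ l hl).resolve_left ?_) k N
        rintro rfl
        rcases List.mem_cons.1 hl with rfl | hl
        · exact lt_irrefl _ (hi _ hj)
        · exact ((List.pairwise_cons.1 hM).1 _ hl).not_gt (hi _ hj)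
  · refine hs.ctl hφi.2 hφi.2 (Filter.Eventually.of_forall fun n a ha b hb hab => ?_)
      (hs.separated_level hj)
    exact absurd hab ((hs.prop n).2 a ha b hb).not_gt

/-! ### Deciding a growth rate -/

/-- Let `lo` be a set of levels such that no level in `lo` controls `g` along any big subset of
`A`. Then creatures in `A` can be chosen such that points separated by `g` are
separated by the levels outside of `lo` (here expressed by the relation `S`): otherwise, the
dichotomy `Creature.refines_or` would provide a big subset of `A` along which `g` is controlled by
some level in `lo`. -/
theorem Big.exists_separated {φ : I → ℕ → ℕ} {J : Set I} (hJ : J.Countable)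
    (hφ : ∀ j ∈ J, Fast (φ j)) {A : Set ℕ} (hA : Big φ J A) {g : ℕ → ℕ} (hg : Fast g)
    {lo : Set I} (hlo : ∀ j ∈ lo, ∀ B ⊆ A, Big φ J B → ¬ Ctl B (φ j) g) {S : ℕ → ℕ → Prop}
    (hsplit : ∀ L : List I, (∀ i ∈ L, i ∈ J) → ∃ H M : List I, (H ++ M).Pairwise (· > ·) ∧
      (∀ i ∈ H ++ M, i ∈ J) ∧ (∀ i ∈ L, i ∈ H ++ M) ∧ (∀ i ∈ M, i ∈ lo) ∧ (∀ i ∈ H, i ∉ lo) ∧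
      ∀ h H₁, (h :: H₁) <:+ H.map φ → ∀ a b, (∀ i ∈ h :: H₁, i a < b) → S a b)
    (L : List I) (hL : L.Pairwise (· > ·)) (hLJ : ∀ i ∈ L, i ∈ J) (k N : ℕ) :
    ∃ s : Finset ℕ, (∀ a ∈ s, N ≤ a) ∧ Creature k (L.map φ) s ∧ ↑s ⊆ A ∧
      ∀ a ∈ s, ∀ b ∈ s, g a < b → S a b := by
  obtain ⟨H₀, M₀, hHM₀, hHMJ₀, hLHM₀, hM₀, hH₀, hS₀⟩ := hsplit L hLJ
  -- It suffices to find a creature with the levels `H₀ ++ M₀`.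
  suffices hsuff : ∃ n, k ≤ n ∧ 1 ≤ n ∧ ∃ s : Finset ℕ, (∀ a ∈ s, N ≤ a) ∧
      Creature n ((H₀ ++ M₀).map φ) s ∧ ↑s ⊆ A ∧ ∀ a ∈ s, ∀ b ∈ s, g a < b → S a b by
    obtain ⟨n, hkn, hn, s, hsN, hs, hsA, hsS⟩ := hsuff
    obtain ⟨t, hts, ht⟩ := Creature.exists_subset hkn hn
      ((sublist_of_decreasing hL hHM₀ hLHM₀).map φ) hs
    exact ⟨t, fun a ha => hsN a (hts ha), ht, fun a ha => hsA (hts ha),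
      fun a ha b hb => hsS a (hts ha) b (hts hb)⟩
  cases M₀ with
  | nil =>
    obtain ⟨s, hsN, hs, hsA⟩ := hA _ hHM₀ hHMJ₀ (max k 1) N
    refine ⟨_, le_max_left k 1, le_max_right _ _, s, hsN, hs, hsA, fun a ha b hb hab => ?_⟩
    rw [List.append_nil] at hs hHMJ₀
    refine Creature.of_lt (fun h hh => ?_) hS₀ hs a ha b hb ((hg.2 a).trans hab)
    obtain ⟨i, hi, rfl⟩ := List.mem_map.1 hh
    exact hφ i (hHMJ₀ i hi)
  | cons j M₀ =>
    by_contra hcon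
    have hjlo : j ∈ lo := hM₀ j List.mem_cons_self
    have hjJ : j ∈ J := hHMJ₀ j (List.mem_append_right _ List.mem_cons_self)
    -- Creatures along which `φ j` controls `g`, for all finite sets of levels.
    have hctl : ∀ L' : List I, L'.Pairwise (· > ·) → (∀ i ∈ L', i ∈ J) → ∀ k' N' : ℕ,
        ∃ s : Finset ℕ, (∀ a ∈ s, N' ≤ a) ∧ Creature k' (L'.map φ) s ∧ (↑s ⊆ A ∧
          Refines (φ j) g s) := by
      intro L' hL' hLJ' k' N'
      obtain ⟨H, M, hHM, hHMJ, hLHM, hM, hH, hS⟩ := hsplit ((H₀ ++ j :: M₀) ++ L') (fun i hi => by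
        rcases List.mem_append.1 hi with hi | hi
        · exact hHMJ₀ i hi
        · exact hLJ' i hi)
      have hsub₀ : ∀ i ∈ H₀ ++ j :: M₀, i ∈ H ++ M :=
        fun i hi => hLHM i (List.mem_append_left _ hi)
      have hjM : j ∈ M := (List.mem_append.1 (hsub₀ j (List.mem_append_right _
        List.mem_cons_self))).resolve_left fun hjH => hH j hjH hjlo
      obtain ⟨H₂, M₁, rfl⟩ := List.append_of_mem hjM
      rw [← List.append_assoc] at hHM
      have hHfast : ∀ h ∈ (H ++ H₂).map φ, Fast h := by
        intro h hh
        obtain ⟨i, hi, rfl⟩ := List.mem_map.1 hh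
        exact hφ i (hHMJ i (by rw [← List.append_assoc]; exact List.mem_append_left _ hi))
      have hn : 1 ≤ max (max k k') 1 := le_max_right _ _
      obtain ⟨K, hK⟩ := Creature.refines_or hg (hφ j hjJ) (M₁.map φ) hn
        (H' := H.map φ) ((List.sublist_append_left H H₂).map φ) hHfast hS
      obtain ⟨s, hsN, hs, hsA⟩ := hA ((H ++ H₂) ++ j :: M₁) hHM
        (fun i hi => hHMJ i (by rwa [← List.append_assoc])) K (max N N')
      obtain ⟨t, hts, h1 | h1⟩ := hK s (by simpa using hs)
      · obtain ⟨u, hut, hu⟩ := Creature.exists_subset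
          (by omega : k' ≤ max (max k k') 1) hn (L := L'.map φ)
          (L' := (H ++ H₂ ++ j :: M₁).map φ)
          ((sublist_of_decreasing hL' hHM fun i hi => by
            rw [List.append_assoc]; exact hLHM i (List.mem_append_right _ hi)).map φ)
          (by simpa using h1.1)
        exact ⟨u, fun a ha => (le_max_right _ _).trans (hsN a (hts (hut ha))), hu,
          fun a ha => hsA (hts (hut ha)), h1.2.1.mono hut⟩
      · -- The other alternative, with the levels `H ++ j :: M₁`, contradicts the assumption.
        exfalso
        have hlt₁ : ∀ i ∈ H₂, j < i := by
          intro i hi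
          exact (List.pairwise_append.1 hHM).2.2 i (List.mem_append_right _ hi) j
            List.mem_cons_self
        have hHM₁ : (H ++ j :: M₁).Pairwise (· > ·) :=
          hHM.sublist ((List.sublist_append_left H H₂).append_right _)
        have hmem : ∀ i ∈ H₀ ++ j :: M₀, i ∈ H ++ j :: M₁ := by
          intro i hi
          rcases List.mem_append.1 (hsub₀ i hi) with h2 | h2
          · exact List.mem_append_left _ h2
          rcases List.mem_append.1 h2 with h3 | h3
          · exfalso
            have hilo := hM i h2
            rcases List.mem_append.1 hi with h4 | h4
            · exact hH₀ i h4 hilo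
            · rcases List.mem_cons.1 h4 with rfl | h5
              · exact lt_irrefl _ (hlt₁ i h3)
              · exact (hlt₁ i h3).not_gt
                  ((List.pairwise_cons.1 (List.pairwise_append.1 hHM₀).2.1).1 i h5)
          · exact List.mem_append_right _ h3
        obtain ⟨u, hut, hu⟩ := Creature.exists_subset le_rfl hn (L := (H₀ ++ j :: M₀).map φ)
          (L' := (H ++ j :: M₁).map φ) ((sublist_of_decreasing hHM₀ hHM₁ hmem).map φ)
          (by simpa using h1.1)
        exact hcon ⟨_, by omega, hn, u, fun a ha => (le_max_left _ _).trans
          (hsN a (hts (hut ha))), hu, fun a ha => hsA (hts (hut ha)),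
          fun a ha b hb => h1.2 a (hut ha) b (hut hb)⟩
    obtain ⟨L', w, s, hs⟩ := exists_isFusion (φ := φ) hJ g
      (P := fun _ s => (s : Set ℕ) ⊆ A ∧ Refines (φ j) g s) hctl
    exact hlo j hjlo _ (Set.iUnion_subset fun n => (hs.prop n).1) hs.big
      (hs.ctl hg.2 (hφ j hjJ).2 (Filter.Eventually.of_forall fun n => (hs.prop n).2)
        (Filter.Eventually.of_forall fun m n hmn a ha b hb => (hs.separated m n hmn a ha b hb).1))

/-- Below a big set, either `g` becomes equivalent to one of the old growth rates, or `g` can serve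
as the growth rate of a new top level. -/
theorem Big.equiv_or_short [WellFoundedLT I] {φ : I → ℕ → ℕ} {J : Set I} (hJ : J.Countable)
    (hφ : ∀ j ∈ J, Fast (φ j)) {A : Set ℕ} (hA : Big φ J A) {g : ℕ → ℕ} (hg : Fast g) :
    (∃ B ⊆ A, Big φ J B ∧ ∃ j ∈ J, Ctl B (φ j) g ∧ Ctl B g (φ j)) ∨
    ∀ L : List I, L.Pairwise (· > ·) → (∀ i ∈ L, i ∈ J) →
      ∀ k N : ℕ, ∃ s : Finset ℕ, (∀ a ∈ s, N ≤ a) ∧ Creature k (L.map φ) s ∧ ↑s ⊆ A ∧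
        Short g s := by
  by_cases hex : ∃ j, j ∈ J ∧ ∃ B ⊆ A, Big φ J B ∧ Ctl B (φ j) g
  · left
    obtain ⟨j, ⟨hj, B, hBA, hB, hBj⟩, hmin⟩ := WellFounded.has_min
      (wellFounded_lt (α := I)) {j | j ∈ J ∧ ∃ B ⊆ A, Big φ J B ∧ Ctl B (φ j) g} hex
    obtain ⟨L, w, s, hs⟩ := exists_isFusion (φ := φ) hJ (φ j)
      (P := fun _ s => (s : Set ℕ) ⊆ B ∧ Refines g (φ j) s)
      (hB.exists_separated hJ hφ hg (lo := {l | l ∈ J ∧ l < j}) (S := fun a b => φ j a < b)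
        (fun l hl C hCB hC hCl => hmin l ⟨hl.1, C, hCB.trans hBA, hC, hCl⟩ hl.2) (by
          intro L hLJ
          obtain ⟨M, hM, hMmem⟩ := exists_decreasing_union L [j]
          obtain ⟨H, M₁, rfl⟩ := List.append_of_mem ((hMmem j).2 (Or.inr (by simp)))
          have hMJ : ∀ i ∈ H ++ j :: M₁, i ∈ J := by
            intro i hi
            rcases (hMmem i).1 hi with h | h
            · exact hLJ i h
            · rw [List.mem_singleton] at h
              exact h ▸ hj
          have hpw := List.pairwise_append.1 hM
          have heq : H ++ [j] ++ M₁ = H ++ j :: M₁ := by simp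
          refine ⟨H ++ [j], M₁, heq ▸ hM, heq ▸ hMJ, fun i hi => heq ▸ (hMmem i).2 (Or.inl hi),
            fun i hi => ⟨hMJ i (by simp [hi]), (List.pairwise_cons.1 hpw.2.1).1 i hi⟩,
            fun i hi hlo => ?_, ?_⟩
          · rcases List.mem_append.1 hi with h | h
            · exact (hpw.2.2 i h j List.mem_cons_self).not_gt hlo.2
            · rw [List.mem_singleton] at h
              exact hlo.2.ne h
          · -- a nonempty final segment of the levels `H ++ [j]` contains `j`
            rintro h H₁ ⟨H₂, hH₂⟩ a b hab
            have hlast : (h :: H₁).getLast (by simp) = φ j := by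
              have h1 : (H₂ ++ h :: H₁).getLast (by simp) = φ j := by
                simp [hH₂]
              rwa [List.getLast_append_of_ne_nil _ (by simp)] at h1
            exact hab _ (hlast ▸ List.getLast_mem (by simp))))
    have hsub : (⋃ n, (s n : Set ℕ)) ⊆ B := Set.iUnion_subset fun n => (hs.prop n).1
    refine ⟨_, hsub.trans hBA, hs.big, j, hj, hBj.mono hsub, hs.ctl (hφ j hj).2 hg.2
      (Filter.Eventually.of_forall fun n => (hs.prop n).2)
      (Filter.Eventually.of_forall fun m n hmn a ha b hb => (hs.separated m n hmn a ha b hb).1)⟩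
  · right
    intro L hL hLJ k N
    obtain ⟨s, h1, h2, h3, h4⟩ := hA.exists_separated hJ hφ hg (lo := J) (S := fun _ _ => False)
      (fun j hj B hBA hB hBj => hex ⟨j, hj, B, hBA, hB, hBj⟩) (by
        intro L hLJ
        obtain ⟨M, hM, hMmem⟩ := exists_decreasing_union L []
        have hMJ : ∀ i ∈ M, i ∈ J := fun i hi =>
          hLJ i (((hMmem i).1 hi).resolve_right (by simp))
        exact ⟨[], M, hM, hMJ, fun i hi => (hMmem i).2 (Or.inl hi), hMJ, by simp, by simp⟩)
      L hL hLJ k N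
    exact ⟨s, h1, h2, h3, fun a ha b hb => not_lt.1 fun hab => h4 a ha b hb hab⟩

/-- One step of the construction: the set is thinned out so that it decides `X`, a new level is
added on top, and the given growth rate `g` becomes equivalent to that of some level. -/
theorem exists_step [WellFoundedLT I] {φ : I → ℕ → ℕ} {i : I} (hi : (Set.Iio i).Countable)
    (hφ : ∀ j < i, Fast (φ j)) {A : Set ℕ} (hA : Big φ (Set.Iio i) A) (X : Set ℕ) {g : ℕ → ℕ}
    (hg : Fast g) :
    ∃ B ⊆ A, (B ⊆ X ∨ B ⊆ Xᶜ) ∧ ∃ ψ : I → ℕ → ℕ, (∀ j < i, ψ j = φ j) ∧ Fast (ψ i) ∧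
      Big ψ (Set.Iic i) B ∧ (∀ j < i, Ctl B (ψ i) (ψ j)) ∧
      ∃ j ≤ i, Ctl B (ψ j) g ∧ Ctl B g (ψ j) := by
  obtain ⟨A₁, hA₁A, hA₁X, hA₁⟩ : ∃ A₁ ⊆ A, (A₁ ⊆ X ∨ A₁ ⊆ Xᶜ) ∧ Big φ (Set.Iio i) A₁ := by
    rcases hA.inter_or_diff X with h | h
    · exact ⟨_, Set.inter_subset_left, Or.inl Set.inter_subset_right, h⟩
    · exact ⟨_, Set.sdiff_subset, Or.inr fun a ha => ha.2, h⟩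
  -- The new level with growth rate `f` is added to a set `A₂`.
  have hadd : ∀ A₂ ⊆ A₁, ∀ f, Fast f → (∀ L : List I, L.Pairwise (· > ·) →
      (∀ i' ∈ L, i' ∈ Set.Iio i) → ∀ k N : ℕ, ∃ s : Finset ℕ, (∀ a ∈ s, N ≤ a) ∧
        Creature k (L.map φ) s ∧ ↑s ⊆ A₂ ∧ Short f s) →
      (f = g ∨ ∃ j ∈ Set.Iio i, Ctl A₂ (φ j) g ∧ Ctl A₂ g (φ j)) →
      ∃ B ⊆ A, (B ⊆ X ∨ B ⊆ Xᶜ) ∧ ∃ ψ : I → ℕ → ℕ, (∀ j < i, ψ j = φ j) ∧ Fast (ψ i) ∧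
        Big ψ (Set.Iic i) B ∧ (∀ j < i, Ctl B (ψ i) (ψ j)) ∧
        ∃ j ≤ i, Ctl B (ψ j) g ∧ Ctl B g (ψ j) := by
    intro A₂ hA₂ f hf hshort hfg
    let ψ := Function.update φ i f
    have hψ : ∀ j < i, ψ j = φ j := fun j hj => Function.update_of_ne hj.ne _ _
    have hψi : ψ i = f := Function.update_self _ _ _
    obtain ⟨B, hB, h1, h2⟩ := exists_big_insert (φ := ψ) hi (fun j hj => hj) (hψi ▸ hf)
      (A := A₂) (by
        intro L hL hLi k N
        have hmap : L.map ψ = L.map φ := List.map_congr_left fun j hj => hψ j (hLi j hj)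
        rw [hψi, hmap]
        exact hshort L hL hLi k N)
    rw [Set.Iio_insert] at h1
    refine ⟨B, hB.trans (hA₂.trans hA₁A), hA₁X.imp (hB.trans hA₂).trans (hB.trans hA₂).trans,
      ψ, hψ, hψi ▸ hf, h1, h2, ?_⟩
    rcases hfg with rfl | ⟨j, hj, h3, h4⟩
    · exact ⟨i, le_rfl, hψi ▸ Ctl.refl _ _, hψi ▸ Ctl.refl _ _⟩
    · exact ⟨j, le_of_lt hj, (hψ j hj) ▸ h3.mono hB, (hψ j hj) ▸ h4.mono hB⟩
  rcases hA₁.equiv_or_short hi hφ hg with ⟨A₂, hA₂, hbig, hj⟩ | h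
  · obtain ⟨f, hf, hshort⟩ := hbig.exists_short hi
    exact hadd A₂ hA₂ f hf hshort (Or.inr hj)
  · exact hadd A₁ subset_rfl g hg h (Or.inl rfl)

end

/-! ### The transfinite construction and the ultrafilter -/

/-- Transfinite recursion for a condition `R i f` that depends on the values of `f` up to `i` only:
if these values can always be extended by one more, then `R i f` can be satisfied for all `i`. -/
theorem exists_forall_of_extend {I P : Type*} [LinearOrder I] [WellFoundedLT I] [Nonempty P]
    (R : I → (I → P) → Prop) (hloc : ∀ i f f', (∀ j ≤ i, f j = f' j) → R i f → R i f')
    (hstep : ∀ i f, (∀ j < i, R j f) → ∃ f', (∀ j < i, f' j = f j) ∧ R i f') :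
    ∃ f, ∀ i, R i f := by
  classical
  let pick : ∀ i, (∀ j, j < i → P) → I → P := fun i rec =>
    Classical.epsilon fun f' => (∀ j (h : j < i), f' j = rec j h) ∧ R i f'
  let f : I → P := (wellFounded_lt (α := I)).fix fun i rec => pick i rec i
  have hf : ∀ i, f i = pick i (fun j _ => f j) i := fun i =>
    (wellFounded_lt (α := I)).fix_eq _ i
  refine ⟨f, fun i => ?_⟩
  induction i using WellFoundedLT.induction with
  | ind i ih =>
    obtain ⟨h1, h2⟩ : (∀ j (_ : j < i), pick i (fun j _ => f j) j = f j) ∧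
      R i (pick i fun j _ => f j) := Classical.epsilon_spec (hstep i f ih)
    refine hloc i _ f (fun j hj => ?_) h2
    rcases hj.lt_or_eq with hj | rfl
    · exact h1 j hj
    · exact (hf j).symm

/-- The transfinite construction: an almost decreasing family of sets `A i`, together with growth
rates `φ i`, that decides all the sets `X i` and makes each `g i` equivalent to some `φ j`. -/
theorem exists_tower {I : Type*} [LinearOrder I] [WellFoundedLT I]
    (hI : ∀ i : I, (Set.Iio i).Countable) (X : I → Set ℕ) (g : I → ℕ → ℕ) (hg : ∀ i, Fast (g i)) :
    ∃ (A : I → Set ℕ) (φ : I → ℕ → ℕ), ∀ i, Fast (φ i) ∧ (∀ j < i, (A i \ A j).Finite) ∧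
      Big φ (Set.Iic i) (A i) ∧ (∀ j < i, Ctl (A i) (φ i) (φ j)) ∧
      (A i ⊆ X i ∨ A i ⊆ (X i)ᶜ) ∧ ∃ j ≤ i, Ctl (A i) (φ j) (g i) ∧ Ctl (A i) (g i) (φ j) := by
  suffices h : ∃ f : I → Set ℕ × (ℕ → ℕ), ∀ i, Fast (f i).2 ∧
      (∀ j < i, ((f i).1 \ (f j).1).Finite) ∧
      Big (fun j => (f j).2) (Set.Iic i) (f i).1 ∧ (∀ j < i, Ctl (f i).1 (f i).2 (f j).2) ∧
      ((f i).1 ⊆ X i ∨ (f i).1 ⊆ (X i)ᶜ) ∧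
      ∃ j ≤ i, Ctl (f i).1 (f j).2 (g i) ∧ Ctl (f i).1 (g i) (f j).2 by
    obtain ⟨f, hf⟩ := h
    exact ⟨fun i => (f i).1, fun i => (f i).2, hf⟩
  refine exists_forall_of_extend _ ?_ ?_
  · rintro i f f' hff' ⟨h1, h2, h3, h4, h5, j, hj, h6⟩
    have hi := hff' i le_rfl
    refine ⟨hi ▸ h1, fun j hj => ?_, hi ▸ h3.congr fun j hj => ?_, fun j hj => ?_, hi ▸ h5, j, hj,
      ?_⟩
    · rw [← hi, ← hff' j hj.le]
      exact h2 j hj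
    · rw [hff' j hj]
    · rw [← hi, ← hff' j hj.le]
      exact h4 j hj
    · rw [← hi, ← hff' j hj]
      exact h6
  · intro i f ih
    obtain ⟨A, hA, hAf⟩ := exists_big_pseudoInter (φ := fun j => (f j).2) (hI i)
      (A := fun j => (f j).1) (fun j hj => (ih j hj).2.2.1)
      (fun j hj l hl => (ih j hj).2.1 l hl)
    obtain ⟨B, hBA, hBX, ψ, h1, h2, h3, h4, h5⟩ :=
      exists_step (hI i) (fun j hj => (ih j hj).1) hA (X i) (hg i)
    let f' : I → Set ℕ × (ℕ → ℕ) := fun j => (if j = i then B else (f j).1, ψ j)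
    have hf'i : (f' i).1 = B := if_pos rfl
    refine ⟨f', fun j hj => Prod.ext (if_neg hj.ne) (h1 j hj), h2, fun j hj => ?_, ?_⟩
    · rw [hf'i, show (f' j).1 = (f j).1 from if_neg hj.ne]
      exact (hAf j hj).subset (Set.sdiff_subset_sdiff_left hBA)
    · rw [hf'i]
      exact ⟨h3, h4, hBX, h5⟩

theorem Big.infinite {I : Type*} [LinearOrder I] {φ : I → ℕ → ℕ} {J : Set I} {A : Set ℕ}
    (h : Big φ J A) : A.Infinite := by
  refine Set.infinite_of_not_bddAbove fun ⟨M, hM⟩ => ?_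
  obtain ⟨s, h1, ⟨a, ha⟩, h2⟩ := h [] List.Pairwise.nil (by simp) 0 (M + 1)
  have ha' : a ∈ s := ha ▸ Finset.mem_singleton_self a
  have := h1 a ha'
  have := hM (h2 ha')
  omega

/-- The continuum hypothesis provides a well-order with countable initial segments of an
uncountable set that can be used to enumerate all functions on `ℕ`. -/
theorem exists_wellOrder_countable_Iio
    (CH : (Cardinal.continuum : Cardinal.{0}) = Cardinal.aleph 1) :
    ∃ (I : Type) (_ : LinearOrder I), WellFoundedLT I ∧ (∀ i : I, (Set.Iio i).Countable) ∧
      Uncountable I ∧ ∃ e : I → ℕ → ℕ, Function.Surjective e := by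
  let I : Type := (Cardinal.continuum : Cardinal.{0}).out
  have hI : Cardinal.mk I = Cardinal.continuum := Cardinal.mk_out _
  obtain ⟨o, wf, ho⟩ := Cardinal.exists_ord_eq_type_lt I
  refine ⟨I, o, wf, fun i => ?_, ?_, ?_⟩
  · have h1 := Cardinal.mk_Iio_lt i ho
    rw [hI, CH, ← Cardinal.succ_aleph0, Order.lt_succ_iff, Cardinal.le_aleph0_iff_set_countable]
      at h1
    exact h1
  · rw [← Cardinal.aleph0_lt_mk_iff, hI]
    exact Cardinal.aleph0_lt_continuum
  · have h2 : Cardinal.mk I = Cardinal.mk (ℕ → ℕ) := by simp [hI]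
    obtain ⟨e⟩ := Cardinal.eq.1 h2
    exact ⟨e, e.surjective⟩

open Clone in
theorem nextIn_spec {A : Set ℕ} (hA : A.Infinite) (n : ℕ) : nextIn A n ∈ A ∧ n < nextIn A n := by
  obtain ⟨a, ha, hn⟩ := hA.exists_gt n
  exact Nat.sInf_mem (s := {a | a ∈ A ∧ n < a}) ⟨a, ha, hn⟩

open Clone in
theorem nextIn_le {A : Set ℕ} {n b : ℕ} (hb : b ∈ A) (hn : n < b) : nextIn A n ≤ b :=
  Nat.sInf_le ⟨hb, hn⟩

/-- Bigness for two levels `j < i` provides long chains of points, each separated by `φ j` from the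
preceding one, that are `φ i`-short. Thus no fixed number of steps of `φ j` and of `nextIn B`
gets as far as `φ i`. -/
theorem Big.exists_iterate_lt {I : Type*} [LinearOrder I] {φ : I → ℕ → ℕ} {J : Set I} {A : Set ℕ}
    (hA : Big φ J A) {i j : I} (hi : i ∈ J) (hj : j ∈ J) (hji : j < i) {B : Set ℕ}
    (hφ : Fast (φ j)) (hAB : (A \ B).Finite) (c : ℕ) :
    ∃ n, (fun x => max (φ j x) (Clone.nextIn B x))^[c] n < φ i n := by
  obtain ⟨N, hN⟩ := hAB.bddAbove
  obtain ⟨s, hsN, ⟨t, rfl, ht, -⟩, hsA⟩ := hA [i, j] (by simpa using hji) (by simp [hi, hj])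
    (c + 2) (N + 1)
  have hB : ∀ a ∈ t 0, a ∈ B := fun a ha => by
    have ha' : a ∈ (Finset.range (c + 2)).biUnion t :=
      Finset.mem_biUnion.2 ⟨0, by simp, ha⟩
    by_contra haB
    have h1 := hN ⟨hsA ha', haB⟩
    have h2 := hsN a ha'
    omega
  obtain ⟨⟨u, hu0, hu, hsep⟩, hshort⟩ := ht 0 (by omega)
  choose a ha using fun m => show ∃ a, m < c + 2 → u m = {a} by
    by_cases hm : m < c + 2
    · obtain ⟨a, ha⟩ := (hu m hm).1
      exact ⟨a, fun _ => ha⟩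
    · exact ⟨0, fun h => absurd h hm⟩
  have hamem : ∀ m < c + 2, a m ∈ t 0 := fun m hm => by
    rw [hu0]
    exact Finset.mem_biUnion.2 ⟨m, Finset.mem_range.2 hm, by simp [ha m hm]⟩
  have hstep : ∀ m, m + 1 < c + 2 → φ j (a m) < a (m + 1) := fun m hm =>
    hsep m (m + 1) (Nat.lt_succ_self m) hm (φ j) List.mem_cons_self (a m)
      (by simp [ha m (by omega)]) (a (m + 1)) (by simp [ha (m + 1) hm])
  have hiter : ∀ m ≤ c, (fun x => max (φ j x) (Clone.nextIn B x))^[m] (a 0) ≤ a m := by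
    intro m
    induction m with
    | zero => exact fun _ => le_rfl
    | succ m ih =>
      intro hm
      have h1 := ih (by omega)
      have h2 := hstep m (by omega)
      rw [Function.iterate_succ_apply']
      refine max_le ((hφ.1 h1).trans h2.le) (nextIn_le (hB _ (hamem _ (by omega))) ?_)
      exact h1.trans_lt ((hφ.2 _).trans h2)
  refine ⟨a 0, (hiter c le_rfl).trans_lt ?_⟩
  calc a c < φ j (a c) := hφ.2 _
    _ < a (c + 1) := hstep c (by omega)
    _ ≤ φ i (a 0) := hshort _ (hamem 0 (by omega)) _ (hamem (c + 1) (by omega))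

/-- The ultrafilter generated by the transfinite construction: growth rates are linearly
preordered by `Ctl` along sets in `U`, and every growth rate is controlled by some `F` for which
there is a function `G` not dominated by any iterate of `x ↦ max (F x) (nextIn A x)`, `A ∈ U`. -/
theorem exists_ultrafilter (CH : (Cardinal.continuum : Cardinal.{0}) = Cardinal.aleph 1) :
    ∃ U : Ultrafilter ℕ, (U : Filter ℕ) ≤ Filter.cofinite ∧
      (∀ f g, Fast f → Fast g → (∃ A ∈ U, Ctl A f g) ∨ ∃ A ∈ U, Ctl A g f) ∧
      ∀ f, Fast f → ∃ F, Fast F ∧ (∃ A ∈ U, Ctl A F f) ∧ ∃ G : ℕ → ℕ, ∀ A ∈ U, ∀ c, ∃ n,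
        (fun x => max (F x) (Clone.nextIn A x))^[c] n < G n := by
  classical
  obtain ⟨I, _, _, hI, hunc, e, he⟩ := exists_wellOrder_countable_Iio CH
  have hsucc : Fast Nat.succ := ⟨fun _ _ h => Nat.succ_le_succ h, Nat.lt_succ_self⟩
  -- Each function on `ℕ` encodes both a set and a growth rate.
  obtain ⟨A, φ, hA⟩ := exists_tower hI (fun i => {n | e i n = 0})
    (fun i => if Fast (e i) then e i else Nat.succ) (fun i => by
      split_ifs with h
      exacts [h, hsucc])
  have hdec : ∀ i j, j ≤ i → (A i \ A j).Finite := fun i j hji => by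
    rcases hji.lt_or_eq with h | rfl
    · exact (hA i).2.1 j h
    · simp
  obtain ⟨i₀⟩ : Nonempty I := inferInstance
  let U₀ : Filter ℕ :=
    { sets := {B | ∃ i, (A i \ B).Finite}
      univ_sets := ⟨i₀, by simp⟩
      sets_of_superset := fun ⟨i, hi⟩ hBC => ⟨i, hi.subset (Set.sdiff_subset_sdiff_right hBC)⟩
      inter_sets := by
        rintro B C ⟨i, hi⟩ ⟨j, hj⟩
        refine ⟨max i j, (((hi.union (hdec _ _ (le_max_left i j))).union
          (hj.union (hdec _ _ (le_max_right i j)))).subset ?_)⟩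
        rintro a ⟨ha, haBC⟩
        simp only [Set.mem_inter_iff, not_and] at haBC
        simp only [Set.mem_union, Set.mem_sdiff]
        tauto }
  have hmem : ∀ B, B ∈ U₀ ↔ ∃ i, (A i \ B).Finite := fun B => Iff.rfl
  have hAmem : ∀ i, A i ∈ U₀ := fun i => ⟨i, by simp⟩
  let U : Ultrafilter ℕ := Ultrafilter.ofComplNotMemIff U₀ (by
    intro B
    constructor
    · intro hB
      obtain ⟨i, hi⟩ := he fun n => if n ∈ B then 0 else 1
      have hX : {n | e i n = 0} = B := by
        ext n
        by_cases h : n ∈ B <;> simp [hi, h]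
      have h := (hA i).2.2.2.2.1
      rw [hX] at h
      rcases h with h | h
      · exact Filter.mem_of_superset (hAmem i) h
      · exact absurd (Filter.mem_of_superset (hAmem i) h) hB
    · rintro ⟨i, hi⟩ ⟨j, hj⟩
      refine (hA (max i j)).2.2.1.infinite (((hi.union (hdec _ _ (le_max_left i j))).union
          (hj.union (hdec _ _ (le_max_right i j)))).subset ?_)
      intro a ha
      simp only [Set.mem_union, Set.mem_sdiff, Set.mem_compl_iff]
      tauto)
  have hUmem : ∀ i, A i ∈ U := hAmem
  -- Every growth rate is equivalent to some `φ j`.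
  have hequiv : ∀ f, Fast f → ∃ i j, Ctl (A i) (φ j) f ∧ Ctl (A i) f (φ j) := by
    intro f hf
    obtain ⟨i, rfl⟩ := he f
    obtain ⟨j, -, h⟩ := (hA i).2.2.2.2.2
    simp only [hf, if_true] at h
    exact ⟨i, j, h⟩
  have hφ : ∀ i j, i ≤ j → Ctl (A j) (φ j) (φ i) := fun i j hij => by
    rcases hij.lt_or_eq with h | rfl
    · exact (hA j).2.2.2.1 i h
    · exact Ctl.refl _ _
  have hlin : ∀ f g, ∀ i j i' j', j ≤ j' → Ctl (A i) (φ j) f →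
      Ctl (A i') g (φ j') → ∃ B ∈ U, Ctl B g f := by
    intro f g i j i' j' hjj' h1 h2
    refine ⟨A i ∩ (A i' ∩ A j'), Filter.inter_mem (hUmem i) (Filter.inter_mem (hUmem i')
      (hUmem j')), ?_⟩
    exact ((h2.mono fun a ha => ha.2.1).trans ((hφ j j' hjj').mono fun a ha => ha.2.2)).trans
      (h1.mono fun a ha => ha.1)
  refine ⟨U, fun B hB => ⟨i₀, ?_⟩, fun f g hf hg => ?_, fun f hf => ?_⟩
  · exact (Filter.mem_cofinite.1 hB).subset fun a ha => ha.2
  · obtain ⟨i, j, h1, h2⟩ := hequiv f hf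
    obtain ⟨i', j', h3, h4⟩ := hequiv g hg
    rcases le_total j j' with h | h
    · exact Or.inr (hlin f g i j i' j' h h1 h4)
    · exact Or.inl (hlin g f i' j' i j h h3 h2)
  · obtain ⟨i, j, h1, -⟩ := hequiv f hf
    obtain ⟨l, hl⟩ : ∃ l, j < l := by
      by_contra hcon
      simp only [not_exists, not_lt] at hcon
      refine Set.not_countable_univ (α := I) ((((hI j).insert j)).mono fun l _ => ?_)
      rw [Set.Iio_insert]
      exact hcon l
    refine ⟨φ j, (hA j).1, ⟨A i, hUmem i, h1⟩, φ l, fun B hB c => ?_⟩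
    obtain ⟨m, hm⟩ := (hmem B).1 hB
    refine (hA (max m l)).2.2.1.exists_iterate_lt (le_max_right m l)
      (hl.le.trans (le_max_right m l)) hl (hA j).1 ?_ c
    refine ((hdec _ _ (le_max_left m l)).union hm).subset fun a ha => ?_
    simp only [Set.mem_union, Set.mem_sdiff]
    have := ha.1
    have := ha.2
    tauto

/-! ### Clones and growth rates -/

open Clone

/-- `D` contains the function `u`, viewed as an operation of arity one. -/
def HasUnary (D : Clone ℕ) (u : ℕ → ℕ) : Prop := (fun x : Fin 1 → ℕ => u (x 0)) ∈ D.ops 0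

theorem ofFilter_le_iff {U : Filter ℕ} {D : Clone ℕ} :
    ofFilter U ≤ D ↔ (∀ (n : ℕ) (f : Operation ℕ n), (∀ x, f x ≤ Finset.univ.sup x) → f ∈ D.ops n) ∧
      ∀ A ∈ U, HasUnary D (nextIn A) := by
  constructor
  · intro h
    refine ⟨fun n f hf => h n fun C hC => hC ⟨n, f⟩ (Or.inl hf), fun A hA => h 0 fun C hC => ?_⟩
    exact hC (nextInOp A) (Or.inr ⟨A, hA, rfl⟩)
  · rintro ⟨h₁, h₂⟩ n f hf
    refine hf D ?_
    rintro p (hp | ⟨A, hA, rfl⟩)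
    · exact h₁ p.1 p.2 hp
    · exact h₂ A hA

theorem mem_of_le_sup {U : Filter ℕ} {D : Clone ℕ} (hD : ofFilter U ≤ D) {n : ℕ}
    {f : Operation ℕ n} (hf : ∀ x, f x ≤ Finset.univ.sup x) : f ∈ D.ops n :=
  (ofFilter_le_iff.1 hD).1 n f hf

/-- Clones above `ofFilter U` are closed under passing to smaller operations. -/
theorem mem_of_le {U : Filter ℕ} {D : Clone ℕ} (hD : ofFilter U ≤ D) {n : ℕ}
    {f g : Operation ℕ n} (hf : f ∈ D.ops n) (hgf : ∀ x, g x ≤ f x) : g ∈ D.ops n := by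
  -- `g x = G (x, f x)`, where `G` is bounded by its last argument
  let G : Operation ℕ (n + 1) := fun y => min (g fun i => y i.castSucc) (y (Fin.last _))
  have hG : G ∈ D.ops (n + 1) := mem_of_le_sup hD fun y =>
    (min_le_right _ _).trans (Finset.le_sup (f := y) (Finset.mem_univ _))
  have h := D.comp_mem (n + 1) n G (fun i => Fin.lastCases f (fun i x => x i) i) hG (fun i => by
    refine Fin.lastCases ?_ (fun i => ?_) i
    · simpa using hf
    · simpa using D.proj_mem n i)
  convert h using 1
  funext x
  simp [G, hgf x]

theorem HasUnary.comp {D : Clone ℕ} {u v : ℕ → ℕ} (hu : HasUnary D u) (hv : HasUnary D v) :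
    HasUnary D (u ∘ v) :=
  D.comp_mem 0 0 _ (fun _ x => v (x 0)) hu fun _ => hv

theorem HasUnary.iterate {D : Clone ℕ} {u : ℕ → ℕ} (hu : HasUnary D u) (c : ℕ) :
    HasUnary D u^[c] := by
  induction c with
  | zero => exact D.proj_mem 0 0
  | succ c ih => exact ih.comp hu

theorem HasUnary.max {U : Filter ℕ} {D : Clone ℕ} (hD : ofFilter U ≤ D) {u v : ℕ → ℕ}
    (hu : HasUnary D u) (hv : HasUnary D v) : HasUnary D fun n => max (u n) (v n) := by
  have hmax : (fun x : Fin 2 → ℕ => Max.max (x 0) (x 1)) ∈ D.ops 1 := mem_of_le_sup hD fun x =>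
    max_le (Finset.le_sup (f := x) (Finset.mem_univ _)) (Finset.le_sup (f := x) (Finset.mem_univ _))
  exact D.comp_mem 1 0 _ ![fun x => u (x 0), fun x => v (x 0)] hmax
    (Fin.forall_fin_two.2 ⟨hu, hv⟩)

theorem HasUnary.of_le {U : Filter ℕ} {D : Clone ℕ} (hD : ofFilter U ≤ D) {u v : ℕ → ℕ}
    (hu : HasUnary D u) (hvu : ∀ n, v n ≤ u n) : HasUnary D v :=
  mem_of_le hD hu fun x => hvu (x 0)

theorem HasUnary.of_le_id {U : Filter ℕ} {D : Clone ℕ} (hD : ofFilter U ≤ D) {u : ℕ → ℕ}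
    (hu : ∀ n, u n ≤ n) : HasUnary D u :=
  HasUnary.of_le hD (show HasUnary D id from D.proj_mem 0 0) hu

theorem HasUnary.nextIn {U : Filter ℕ} {D : Clone ℕ} (hD : ofFilter U ≤ D) {A : Set ℕ}
    (hA : A ∈ U) : HasUnary D (Clone.nextIn A) :=
  (ofFilter_le_iff.1 hD).2 A hA

theorem HasUnary.succ {U : Filter ℕ} {D : Clone ℕ} (hD : ofFilter U ≤ D) :
    HasUnary D Nat.succ :=
  HasUnary.of_le hD (HasUnary.nextIn hD Filter.univ_mem) fun n =>
    (nextIn_spec Set.infinite_univ n).2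

theorem HasUnary.const {U : Filter ℕ} {D : Clone ℕ} (hD : ofFilter U ≤ D) (c : ℕ) :
    HasUnary D fun _ => c :=
  HasUnary.of_le hD ((HasUnary.succ hD).iterate c) fun n => by
    rw [Nat.succ_iterate]
    omega

theorem HasUnary.of_eventually_le {U : Filter ℕ} {D : Clone ℕ} (hD : ofFilter U ≤ D)
    {u v : ℕ → ℕ} (hu : HasUnary D u) (hv : Monotone v) {N : ℕ} (hvu : ∀ n, N ≤ n → v n ≤ u n) :
    HasUnary D v :=
  HasUnary.of_le hD (HasUnary.max hD hu (HasUnary.const hD (v N))) fun n => by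
    rcases le_total N n with h | h
    · exact (hvu n h).trans (le_max_left _ _)
    · exact (hv h).trans (le_max_right _ _)

/-- A function controlled by `f` along a set in `U` belongs to every clone above `ofFilter U` that
contains `f`. -/
theorem HasUnary.of_ctl {U : Filter ℕ} {D : Clone ℕ} (hD : ofFilter U ≤ D) {A : Set ℕ}
    (hA : A ∈ U) (hinf : A.Infinite) {f g : ℕ → ℕ} (hg : Monotone g) (h : Ctl A f g)
    (hf : HasUnary D f) : HasUnary D g := by
  obtain ⟨N, hN⟩ := h
  have hnext := HasUnary.nextIn hD hA
  refine HasUnary.of_eventually_le hD (hnext.comp (hf.comp hnext)) hg (N := N) fun n hn => ?_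
  obtain ⟨h1, h2⟩ := nextIn_spec hinf n
  obtain ⟨h3, h4⟩ := nextIn_spec hinf (f (Clone.nextIn A n))
  exact (hg h2.le).trans (hN _ h1 (hn.trans h2.le) _ h3 h4).le

/-- The least growth rate that bounds the operation `f` in terms of the maximum of its arguments. -/
def majorant {n : ℕ} (f : Operation ℕ n) (m : ℕ) : ℕ :=
  max (m + 1) ((Fintype.piFinset fun _ : Fin (n + 1) => Finset.range (m + 1)).sup f)

theorem fast_majorant {n : ℕ} (f : Operation ℕ n) : Fast (majorant f) := by
  refine ⟨fun m m' h => max_le_max (Nat.succ_le_succ h) (Finset.sup_mono ?_),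
    fun m => lt_of_lt_of_le (Nat.lt_succ_self m) (le_max_left _ _)⟩
  exact Fintype.piFinset_subset _ _ fun _ => Finset.range_mono (Nat.succ_le_succ h)

theorem le_majorant {n : ℕ} (f : Operation ℕ n) (x : Fin (n + 1) → ℕ) :
    f x ≤ majorant f (Finset.univ.sup x) := by
  refine le_trans (Finset.le_sup (f := f) ?_) (le_max_right _ _)
  exact Fintype.mem_piFinset.2 fun i =>
    Finset.mem_range.2 (Nat.lt_succ_of_le (Finset.le_sup (f := x) (Finset.mem_univ i)))

/-- Clones above `ofFilter U` are determined by the growth rates that they contain. -/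
theorem hasUnary_majorant_iff {U : Filter ℕ} {D : Clone ℕ} (hD : ofFilter U ≤ D) {n : ℕ}
    {f : Operation ℕ n} : HasUnary D (majorant f) ↔ f ∈ D.ops n := by
  constructor
  · intro h
    refine mem_of_le hD (D.comp_mem 0 n _ (fun _ x => Finset.univ.sup x) h fun _ =>
      mem_of_le_sup hD fun x => le_rfl) fun x => le_majorant f x
  · intro h
    -- The arguments at which the maximum is attained are bounded by the identity.
    have hex : ∀ m, ∃ x : Fin (n + 1) → ℕ, (∀ i, x i ≤ m) ∧
        (Fintype.piFinset fun _ : Fin (n + 1) => Finset.range (m + 1)).sup f = f x := by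
      intro m
      obtain ⟨x, hx, hfx⟩ := Finset.exists_mem_eq_sup
        (Fintype.piFinset fun _ : Fin (n + 1) => Finset.range (m + 1))
        ⟨fun _ => 0, by simp⟩ f
      exact ⟨x, fun i => Nat.le_of_lt_succ (Finset.mem_range.1 (Fintype.mem_piFinset.1 hx i)), hfx⟩
    choose x hx hfx using hex
    refine HasUnary.max hD (HasUnary.succ hD) ?_
    have h1 := D.comp_mem n 0 f (fun i y => x (y 0) i) h fun i =>
      HasUnary.of_le_id hD fun m => hx m i
    simpa only [HasUnary, hfx] using h1

/-- One step of `F` or of `nextIn A`, whichever goes further. -/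
noncomputable def step (F : ℕ → ℕ) (A : Set ℕ) (n : ℕ) : ℕ := max (F n) (nextIn A n)

theorem step_mono {F : ℕ → ℕ} (hF : Monotone F) {A B : Set ℕ} (hB : B.Infinite) (hBA : B ⊆ A)
    {m n : ℕ} (hmn : m ≤ n) : step F A m ≤ step F B n := by
  obtain ⟨h1, h2⟩ := nextIn_spec hB n
  exact max_le_max (hF hmn) (nextIn_le (hBA h1) (hmn.trans_lt h2))

theorem step_iterate_mono {F : ℕ → ℕ} (hF : Fast F) {A B : Set ℕ} (hB : B.Infinite) (hBA : B ⊆ A)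
    {c d m n : ℕ} (hcd : c ≤ d) (hmn : m ≤ n) : (step F A)^[c] m ≤ (step F B)^[d] n := by
  obtain ⟨e, rfl⟩ := Nat.exists_eq_add_of_le hcd
  have h1 : ∀ c, (step F A)^[c] m ≤ (step F B)^[c] n := by
    intro c
    induction c with
    | zero => exact hmn
    | succ c ih =>
      rw [Function.iterate_succ_apply', Function.iterate_succ_apply']
      exact step_mono hF.1 hB hBA ih
  have h2 : ∀ e n, n ≤ (step F B)^[e] n := by
    intro e n
    induction e with
    | zero => exact le_rfl
    | succ e ih =>
      rw [Function.iterate_succ_apply']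
      exact ih.trans ((hF.2 _).le.trans (le_max_left _ _))
  rw [add_comm, Function.iterate_add_apply]
  exact (h1 c).trans (h2 e _)

/-- The clone generated by `ofFilter U` and the growth rate `F`, described explicitly: it
consists of the operations dominated by an iterate of `step F A`, for some `A ∈ U`. -/
noncomputable def growthClone (U : Filter ℕ) (hU : ∀ A ∈ U, A.Infinite) (F : ℕ → ℕ) (hF : Fast F) :
    Clone ℕ where
  ops _ := {f | ∃ A ∈ U, ∃ c, ∀ x, f x ≤ (step F A)^[c] (Finset.univ.sup x)}
  proj_mem _ i := ⟨Set.univ, Filter.univ_mem, 0, fun x => Finset.le_sup (Finset.mem_univ i)⟩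
  comp_mem := by
    rintro n m f g ⟨A, hA, c, hf⟩ hg
    choose B hB d hgd using hg
    have hC : A ∩ ⋂ i, B i ∈ U := Filter.inter_mem hA (Filter.iInter_mem.2 hB)
    refine ⟨_, hC, c + Finset.univ.sup d, fun x => (hf _).trans ?_⟩
    rw [Function.iterate_add_apply]
    refine step_iterate_mono hF (hU _ hC) Set.inter_subset_left le_rfl (Finset.sup_le fun i _ => ?_)
    exact (hgd i x).trans (step_iterate_mono hF (hU _ hC)
      (Set.inter_subset_right.trans (Set.iInter_subset B i))
      (Finset.le_sup (f := d) (Finset.mem_univ i)) le_rfl)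

theorem ofFilter_le_growthClone {U : Filter ℕ} (hU : ∀ A ∈ U, A.Infinite) {F : ℕ → ℕ}
    (hF : Fast F) : ofFilter U ≤ growthClone U hU F hF := by
  refine ofFilter_le_iff.2 ⟨fun n f hf => ⟨Set.univ, Filter.univ_mem, 0, hf⟩, fun A hA =>
    ⟨A, hA, 1, fun x => ?_⟩⟩
  exact (le_max_right _ _).trans (step_mono hF.1 (hU A hA) subset_rfl
    (Finset.le_sup (f := x) (Finset.mem_univ 0)))

theorem hasUnary_growthClone {U : Filter ℕ} (hU : ∀ A ∈ U, A.Infinite) {F : ℕ → ℕ} (hF : Fast F) :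
    HasUnary (growthClone U hU F hF) F :=
  ⟨Set.univ, Filter.univ_mem, 1, fun x => (hF.1 (Finset.le_sup (f := x)
    (Finset.mem_univ 0))).trans (le_max_left _ _)⟩

theorem growthClone_ne_top {U : Filter ℕ} (hU : ∀ A ∈ U, A.Infinite) {F : ℕ → ℕ} (hF : Fast F)
    {G : ℕ → ℕ} (hG : ∀ A ∈ U, ∀ c, ∃ n, (step F A)^[c] n < G n) :
    growthClone U hU F hF ≠ ⊤ := by
  intro htop
  have h : (fun x : Fin 1 → ℕ => G (x 0)) ∈ (growthClone U hU F hF).ops 0 := htop ▸ mem_top _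
  obtain ⟨A, hA, c, h⟩ := h
  obtain ⟨n, hn⟩ := hG A hA c
  have hsup : (Finset.univ.sup fun _ : Fin 1 => n) = n := Finset.sup_const Finset.univ_nonempty n
  exact ((h fun _ => n).trans_eq (by rw [hsup])).not_gt hn

/-- Countably many growth rates have a common bound. -/
theorem exists_fast_eventually_ge (f : ℕ → ℕ → ℕ) (hf : ∀ m, Fast (f m)) :
    ∃ g, Fast g ∧ ∀ m n, m ≤ n → f m n ≤ g n := by
  refine ⟨fun n => (Finset.range (n + 1)).sup fun m => f m n, ⟨fun n n' h => ?_, fun n => ?_⟩,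
    fun m n h => ?_⟩
  · exact (Finset.sup_mono_fun fun m _ => (hf m).1 h).trans
      (Finset.sup_mono (Finset.range_mono (Nat.succ_le_succ h)))
  · exact ((hf 0).2 n).trans_le (Finset.le_sup (f := fun m => f m n) (by simp))
  · exact Finset.le_sup (f := fun m => f m n) (Finset.mem_range.2 (Nat.lt_succ_of_le h))

theorem exists_fast_not_hasUnary {U : Filter ℕ} {D : Clone ℕ} (hD : ofFilter U ≤ D) (h : D ≠ ⊤) :
    ∃ f, Fast f ∧ ¬ HasUnary D f := by
  by_contra hcon
  simp only [not_exists, not_and, not_not] at hcon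
  exact h (top_le_iff.1 fun n f _ => (hasUnary_majorant_iff hD).1 (hcon _ (fast_majorant f)))

/-- The interval above `ofFilter U` is a chain because growth
rates are comparable modulo `U`, and it has no coatom because every growth rate lies in a proper
clone of the interval. -/
theorem exists_ultrafilter_clone (CH : (Cardinal.continuum : Cardinal.{0}) = Cardinal.aleph 1) :
    ∃ U : Ultrafilter ℕ, (U : Filter ℕ) ≤ Filter.cofinite ∧
      ofFilter U ≠ ⊤ ∧
      (∀ M : Clone ℕ, IsCoatom M → ¬ ofFilter U ≤ M) ∧
      (∀ C D : Clone ℕ, ofFilter U ≤ C → ofFilter U ≤ D → C ≤ D ∨ D ≤ C) ∧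
      (∀ M : Set.Ici (ofFilter U), ¬ IsCoatom M) ∧
      (∀ S : Set (Clone ℕ), S.Countable →
        (∀ C ∈ S, ofFilter U ≤ C ∧ C ≠ ⊤) →
        ∃ D : Clone ℕ, ofFilter U ≤ D ∧ D ≠ ⊤ ∧ ∀ C ∈ S, C ≤ D) := by
  obtain ⟨U, hcof, hcomp, hbound⟩ := exists_ultrafilter CH
  have hU : ∀ A ∈ (U : Filter ℕ), A.Infinite := fun A hA hfin => by
    have h1 : Aᶜ ∈ (U : Filter ℕ) := hcof hfin.compl_mem_cofinite
    exact Ultrafilter.compl_notMem_iff.2 hA h1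
  have hlin : ∀ C D : Clone ℕ, ofFilter U ≤ C → ofFilter U ≤ D → C ≤ D ∨ D ≤ C := by
    intro C D hC hD
    by_contra hcon
    simp only [not_or, le_iff, not_forall, Set.not_subset] at hcon
    obtain ⟨⟨n, f, hfC, hfD⟩, m, g, hgD, hgC⟩ := hcon
    rw [← hasUnary_majorant_iff hC] at hfC hgC
    rw [← hasUnary_majorant_iff hD] at hfD hgD
    rcases hcomp _ _ (fast_majorant f) (fast_majorant g) with ⟨A, hA, h⟩ | ⟨A, hA, h⟩
    · exact hgC (HasUnary.of_ctl hC hA (hU A hA) (fast_majorant g).1 h hfC)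
    · exact hfD (HasUnary.of_ctl hD hA (hU A hA) (fast_majorant f).1 h hgD)
  have hproper : ∀ f, Fast f → ∃ D : Clone ℕ, ofFilter U ≤ D ∧ D ≠ ⊤ ∧ HasUnary D f := by
    intro f hf
    obtain ⟨F, hF, ⟨A, hA, hctl⟩, G, hG⟩ := hbound f hf
    have hle := ofFilter_le_growthClone hU hF
    exact ⟨_, hle, growthClone_ne_top hU hF hG, HasUnary.of_ctl hle hA (hU A hA) hf.1 hctl
      (hasUnary_growthClone hU hF)⟩
  have hcoatom : ∀ M : Set.Ici (ofFilter (U : Filter ℕ)), ¬ IsCoatom M := by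
    intro M hM
    have hMtop : (M : Clone ℕ) ≠ ⊤ := fun h => hM.1 (Subtype.ext h)
    obtain ⟨f, hf, hfM⟩ := exists_fast_not_hasUnary M.2 hMtop
    obtain ⟨D, hD, hDtop, hfD⟩ := hproper f hf
    rcases hlin D M hD M.2 with h | h
    · exact hfM (h 0 hfD)
    · have hlt : M < ⟨D, hD⟩ := lt_of_le_of_ne h fun heq => hfM (heq ▸ hfD)
      exact hDtop (congrArg Subtype.val (hM.2 _ hlt))
  refine ⟨U, hcof, ?_, fun M hM hle => ?_, hlin, hcoatom, fun S hS hSU => ?_⟩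
  · obtain ⟨D, hD, hDtop, -⟩ := hproper _ (fast_majorant fun x : Fin 1 → ℕ => x 0)
    exact fun h => hDtop (top_le_iff.1 (h ▸ hD))
  · refine hcoatom ⟨M, hle⟩ ⟨fun h => hM.1 (congrArg Subtype.val h), fun D hD => ?_⟩
    exact Subtype.ext (hM.2 D hD)
  · choose! f hf hfC using fun C (hC : C ∈ S) => exists_fast_not_hasUnary (hSU C hC).1 (hSU C hC).2
    obtain ⟨g, hg, hle⟩ : ∃ g, Fast g ∧ ∀ C ∈ S, ∃ N, ∀ n, N ≤ n → f C n ≤ g n := by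
      rcases S.eq_empty_or_nonempty with rfl | hne
      · exact ⟨_, fast_majorant fun x : Fin 1 → ℕ => x 0, by simp⟩
      · obtain ⟨e, rfl⟩ := hS.exists_eq_range hne
        obtain ⟨g, hg, hle⟩ := exists_fast_eventually_ge (fun m => f (e m))
          fun m => hf _ (Set.mem_range_self m)
        exact ⟨g, hg, by rintro _ ⟨m, rfl⟩; exact ⟨m, hle m⟩⟩
    obtain ⟨D, hD, hDtop, hgD⟩ := hproper g hg
    refine ⟨D, hD, hDtop, fun C hC => (hlin C D (hSU C hC).1 hD).resolve_right fun hDC => ?_⟩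
    obtain ⟨N, hN⟩ := hle C hC
    exact hfC C hC (HasUnary.of_eventually_le (hSU C hC).1 (hDC 0 hgD) (hf C hC).1 hN)

/-- A bijection of the base sets turns clones into clones. -/
def cloneMap {X Y : Type*} (e : X ≃ Y) (C : Clone X) : Clone Y where
  ops _ := {f | (fun x => e.symm (f (e ∘ x))) ∈ C.ops _}
  proj_mem n i := by simpa using C.proj_mem n i
  comp_mem n m f g hf hg := by
    have h := C.comp_mem n m _ _ hf hg
    simpa [Function.comp_def] using h

/-- Equinumerous sets have isomorphic clone lattices. -/
def cloneEquiv {X Y : Type*} (e : X ≃ Y) : Clone X ≃o Clone Y where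
  toFun := cloneMap e
  invFun := cloneMap e.symm
  left_inv C := by
    ext n f
    simp [cloneMap, Function.comp_def]
  right_inv C := by
    ext n f
    simp [cloneMap, Function.comp_def]
  map_rel_iff' {C D} := by
    refine ⟨fun h n f hf => ?_, fun h n f hf => h n hf⟩
    have := @h n (fun y => e (f (e.symm ∘ y)))
    simpa [cloneMap, Function.comp_def, hf] using this

end GrowthClone

theorem mainTheorem1 (CH : (Cardinal.continuum : Cardinal.{0}) = Cardinal.aleph 1) :
    (∀ (X : Type*) [Countable X] [Infinite X],
      ¬ IsCoatomic (Clone X) ∧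
      ∃ C : Clone X, C ≠ ⊤ ∧ ∀ M : Clone X, IsCoatom M → ¬ C ≤ M) ∧
    ∃ U : Ultrafilter ℕ, (U : Filter ℕ) ≤ Filter.cofinite ∧
      Clone.ofFilter U ≠ ⊤ ∧
      (∀ M : Clone ℕ, IsCoatom M → ¬ Clone.ofFilter U ≤ M) ∧
      (∀ C D : Clone ℕ, Clone.ofFilter U ≤ C → Clone.ofFilter U ≤ D → C ≤ D ∨ D ≤ C) ∧
      (∀ M : Set.Ici (Clone.ofFilter U), ¬ IsCoatom M) ∧
      (∀ S : Set (Clone ℕ), S.Countable →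
        (∀ C ∈ S, Clone.ofFilter U ≤ C ∧ C ≠ ⊤) →
        ∃ D : Clone ℕ, Clone.ofFilter U ≤ D ∧ D ≠ ⊤ ∧ ∀ C ∈ S, C ≤ D) := by
  have key := GrowthClone.exists_ultrafilter_clone CH
  refine ⟨fun X _ _ => ?_, key⟩
  obtain ⟨U, -, htop, hcoatom, -⟩ := key
  obtain ⟨e⟩ : Nonempty (ℕ ≃ X) := by
    obtain ⟨_⟩ := nonempty_denumerable X
    exact ⟨(Denumerable.eqv X).symm⟩
  let E := GrowthClone.cloneEquiv e
  have hne : E (Clone.ofFilter U) ≠ ⊤ := fun h => htop (E.injective (h.trans (map_top E).symm))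
  have hno : ∀ M : Clone X, IsCoatom M → ¬ E (Clone.ofFilter U) ≤ M := fun M hM hle =>
    hcoatom (E.symm M) ((E.symm.isCoatom_iff M).2 hM) (E.le_symm_apply.2 hle)
  refine ⟨fun h => ?_, _, hne, hno⟩
  rcases h.eq_top_or_exists_le_coatom (E (Clone.ofFilter U)) with h | ⟨M, hM, hle⟩
  · exact hne h
  · exact hno M hM hle
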